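/- Let $\Omega\subset\mathbb{R}^n$ be open, $1\le p\le\infty$, let $A:L^p(\Omega)\to L^p(\Omega)$ be a bounded linear operator, $u_0\in L^p(\Omega)$, and let $\alpha\in L^\infty(\Omega)$ satisfy $\alpha(x)\in[\alpha_0,1]$ for almost every $x\in\Omega$, for some $\alpha_0\in(0,1)$. Let $f:[0,\infty)\times L^p(\Omega)\to L^p(\Omega)$ be continuous, map bounded sets to bounded sets, and be locally Lipschitz in the second variable, uniformly with respect to the first: for every $(t_0,\phi_0)\in[0,\infty)\times L^p(\Omega)$ there are $r_0,L_0>0$ with $\|f(t,\psi)-f(t,\phi)\|_{L^p(\Omega)}\le L_0\|\psi-\phi\|_{L^p(\Omega)}$ whenever $t\ge 0$, $|t-t_0|+\|\psi-\phi_0\|_{L^p(\Omega)}<r_0$ and $|t-t_0|+\|\phi-\phi_0\|_{L^p(\Omega)}<r_0$. Consider the problem $$cD_t^{\alpha(x)}u(t,x)=Au(t,x)+f(t,u(t,x)),\qquad u(0,x)=u_0(x).\tag{P}$$ Here, for $\varphi\in C(I;L^p(\Omega))$ with $I=[0,T]$ or $I=[0,\infty)$, the Caputo derivative is $cD_t^{\alpha(x)}\varphi=\frac{d}{dt}J_t^{1-\alpha(x)}\big[\varphi(t,x)-\varphi(0,x)\big]$,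 where $J_t^{0}g(t,x)=g(t,x)$, $J_t^{\beta(x)}g(t,x)=\frac1{\Gamma(\beta(x))}\int_0^t(t-s)^{\beta(x)-1}g(s,x)\,ds$ if $\beta(x)\in(0,1]$, and $\frac{d}{dt}$ is the derivative (one-sided at end points) of a function from $I$ to $L^p(\Omega)$. A solution of (P) on $I\times\Omega$ is a $\varphi\in C(I;L^p(\Omega))$ with $\varphi(0)=u_0$ whose Caputo derivative exists and equals $A\varphi(t)+f(t,\varphi(t))$ in $L^p(\Omega)$ for every $t\in I$. For $\omega\in(0,\infty)$, a function $\varphi:[0,\omega)\to L^p(\Omega)$ is a maximal solution on $[0,\omega)\times\Omega$ if it is the unique solution of (P) on $[0,\tau]\times\Omega$ for all $\tau\in(0,\omega)$ and cannot be extended to $[0,\omega]$ as a solution of (P) on $[0,\omega]\times\Omega$. Then exactly one of the following holds: (i) (P) has a global solution $\varphi\in C([0,\infty);L^p(\Omega))$; (ii) there are $\omega\in(0,\infty)$ and $\varphi\in C([0,\omega);L^p(\Omega))$ such that $\varphi$ is a maximal solution of (P) on $[0,\omega)\times\Omega$. Moreover, every maximal solution $\varphi$ of (P) on some $[0,\omega)\times\Omega$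 with $\omega\in(0,\infty)$ satisfies $$\limsup_{t\to\omega^-}\|\varphi(t,\cdot)\|_{L^p(\Omega)}=\infty.$$ -/

import Mathlib

open MeasureTheory Set Filter Topology
open scoped ENNReal

noncomputable section

namespace VarOrder

/-- The real Lebesgue space `L^p(Ω)` of a subset `Ω` of `ℝⁿ`. -/
abbrev LpOn {n : ℕ} (p : ℝ≥0∞) (Ω : Set (EuclideanSpace ℝ (Fin n))) : Type :=
  Lp ℝ p (volume.restrict Ω)

/-- The Riemann-Liouville fractional integral, of order `β ∈ [0, 1]` and at time `t`, of a scalar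
function; the order `0` gives back the function. -/
def rlIntegral (β : ℝ) (g : ℝ → ℝ) (t : ℝ) : ℝ :=
  if β = 0 then g t else (Real.Gamma β)⁻¹ * ∫ s in (0 : ℝ)..t, (t - s) ^ (β - 1) * g s

/-- The fractional integral of order `β` of `g` exists at time `t`. -/
def RLIntegrable (β : ℝ) (g : ℝ → ℝ) (t : ℝ) : Prop :=
  β = 0 ∨ IntervalIntegrable (fun s => (t - s) ^ (β - 1) * g s) volume 0 t

variable {n : ℕ} {p : ℝ≥0∞} {Ω : Set (EuclideanSpace ℝ (Fin n))}

/-- `Φ` is a jointly measurable function `(t, x) ↦ φ(t, x)` on `I × Ω` which represents the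
`L^p(Ω)`-valued function `φ` at every time `t ∈ I`. (An element of `L^p(Ω)` is only a class of
functions, so that integrals in time at a fixed point `x` need such a representative; two of them
agree at almost every `(t, x)`, and at each `t ∈ I` for almost every `x`.) -/
structure IsRepresentativeOn (I : Set ℝ) (φ : ℝ → LpOn p Ω)
    (Φ : ℝ → EuclideanSpace ℝ (Fin n) → ℝ) : Prop where
  aestronglyMeasurable :
    AEStronglyMeasurable (Function.uncurry Φ) ((volume.restrict I).prod (volume.restrict Ω))
  ae_eq : ∀ t ∈ I, Φ t =ᵐ[volume.restrict Ω] φ t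

/-- `W(t) ∈ L^p(Ω)` is the Riemann-Liouville fractional integral of variable order `β(x)` of `φ`:
for every `t ∈ I` and almost every `x ∈ Ω`, the fractional integral of order `β(x)` of `φ(·, x)`
exists at `t` and equals `W(t, x)`. -/
def IsRLIntegralOn (β : EuclideanSpace ℝ (Fin n) → ℝ) (I : Set ℝ) (φ W : ℝ → LpOn p Ω) : Prop :=
  ∃ Φ : ℝ → EuclideanSpace ℝ (Fin n) → ℝ, IsRepresentativeOn I φ Φ ∧
    ∀ t ∈ I, ∀ᵐ x ∂(volume.restrict Ω),
      RLIntegrable (β x) (fun s => Φ s x) t ∧ W t x = rlIntegral (β x) (fun s => Φ s x) t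

/-- `g` is the Riemann-Liouville fractional derivative of variable order `α(x)` of `φ` on `I`: the
fractional integral of order `1 - α(x)` of `φ` is differentiable in time, as a function from `I`
to `L^p(Ω)` (one-sidedly at end points of `I`), with derivative `g`. -/
def HasRLDerivOn [Fact (1 ≤ p)] (α : EuclideanSpace ℝ (Fin n) → ℝ) (I : Set ℝ)
    (φ g : ℝ → LpOn p Ω) : Prop :=
  ∃ W : ℝ → LpOn p Ω, IsRLIntegralOn (fun x => 1 - α x) I φ W ∧
    ∀ t ∈ I, HasDerivWithinAt W (g t) I t

/-- `g` is the Caputo fractional derivative of variable order `α(x)` of `φ` on `I`. -/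
def HasCaputoDerivOn [Fact (1 ≤ p)] (α : EuclideanSpace ℝ (Fin n) → ℝ) (I : Set ℝ)
    (φ g : ℝ → LpOn p Ω) : Prop :=
  HasRLDerivOn α I (fun t => φ t - φ 0) g

/-- `φ ∈ C(I; L^p(Ω))` solves `cD_t^{α(x)} φ = A φ + f(t, φ)` on `I × Ω`, `φ(0) = u₀`. Only the
values of `φ` on `I` matter (`0 ∈ I` in all uses). -/
structure IsSolutionOn [Fact (1 ≤ p)] (α : EuclideanSpace ℝ (Fin n) → ℝ)
    (A : LpOn p Ω →L[ℝ] LpOn p Ω) (f : ℝ → LpOn p Ω → LpOn p Ω) (u₀ : LpOn p Ω)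
    (I : Set ℝ) (φ : ℝ → LpOn p Ω) : Prop where
  continuousOn : ContinuousOn φ I
  caputo : HasCaputoDerivOn α I φ (fun t => A (φ t) + f t (φ t))
  initial : φ 0 = u₀

/-- `φ` is a maximal solution on `[0, ω) × Ω`: it is the unique solution on `[0, τ] × Ω` for every
`τ ∈ (0, ω)`, and it cannot be extended to `[0, ω] × Ω` as a solution. -/
structure IsMaximalSolution [Fact (1 ≤ p)] (α : EuclideanSpace ℝ (Fin n) → ℝ)
    (A : LpOn p Ω →L[ℝ] LpOn p Ω) (f : ℝ → LpOn p Ω → LpOn p Ω) (u₀ : LpOn p Ω)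
    (ω : ℝ) (φ : ℝ → LpOn p Ω) : Prop where
  pos : 0 < ω
  solution : ∀ τ ∈ Ioo 0 ω, IsSolutionOn α A f u₀ (Icc 0 τ) φ
  unique : ∀ τ ∈ Ioo 0 ω, ∀ ψ : ℝ → LpOn p Ω,
    IsSolutionOn α A f u₀ (Icc 0 τ) ψ → EqOn ψ φ (Icc 0 τ)
  not_extendable : ¬ ∃ ψ : ℝ → LpOn p Ω,
    IsSolutionOn α A f u₀ (Icc 0 ω) ψ ∧ EqOn ψ φ (Ico 0 ω)

/-- `f : [0, ∞) × X → X` is locally Lipschitz in the second variable, uniformly with respect to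
the first variable. -/
def LocallyLipschitzSnd {X : Type*} [NormedAddCommGroup X] (f : ℝ → X → X) : Prop :=
  ∀ t₀ : ℝ, 0 ≤ t₀ → ∀ φ₀ : X, ∃ r > 0, ∃ L > 0, ∀ t : ℝ, 0 ≤ t → ∀ ψ φ : X,
    |t - t₀| + ‖ψ - φ₀‖ < r → |t - t₀| + ‖φ - φ₀‖ < r → ‖f t ψ - f t φ‖ ≤ L * ‖ψ - φ‖

/-- `f : [0, ∞) × X → X` maps bounded sets to bounded sets. -/
def MapsBoundedToBounded {X : Type*} [NormedAddCommGroup X] (f : ℝ → X → X) : Prop :=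
  ∀ B : Set (ℝ × X), B ⊆ Ici 0 ×ˢ univ → Bornology.IsBounded B →
    Bornology.IsBounded (Function.uncurry f '' B)

end VarOrder

end

noncomputable section

namespace VarOrder

/-! Problem (P) is equivalent to the Volterra equation `φ(t) = u₀ + ∫₀ᵗ K(t - s) F(s, φ(s)) ds` with
`F(t, v) = A v + f(t, v)`, where `K(r)` is multiplication by `r^(α(x)-1) / Γ(α(x))` on `L^p(Ω)`. The
bound `α ≥ α₀ > 0` gives `‖K(r)‖ ≤ C r^(α₀-1)` on `(0, T]`, so `K` is locally integrable in operator
norm, and from then on only this integrability matters.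

The equivalence (`hasRLDerivOn_of_eq_volterra`, `HasRLDerivOn.eq_volterra`) rests on the semigroup
law `J^a J^b = J^(a+b)`, applied for almost every fixed `x`. In one direction `J^(1-α) J^α g = J^1
g`, whose time derivative is `g`. In the other, if `J^(1-α) ψ` has derivative `g` and vanishes at
`0`, it equals `J^1 g`; applying `J^α` gives `J^1 ψ = J^1 J^α g`, hence `ψ = J^α g`. Jointly
measurable representatives link Bochner integrals in `L^p` to these scalar integrals.

For the Volterra equation, two arguments that agree up to time `τ` have convolutions that differ on
`[τ, τ + δ]` by at most `∫₀^δ ‖K‖` times the difference of the integrands. With the local Lipschitz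
bound this yields uniqueness and, by the contraction principle, continuation past any closed
interval of existence. Hence the times reached by solutions are unbounded, which gives a global
solution, or have a supremum `ω` that is not attained, which gives a maximal one. A solution bounded
on `[0, ω)` has bounded `F(s, φ(s))`, so its convolution extends continuously to `ω`; this forces
blow-up of maximal solutions. -/

/-! ### Beta integrals and the semigroup law for scalar fractional integrals. -/

lemma integral_rpow_mul_sub_rpow {a b d : ℝ} (ha : 0 < a) (hb : 0 < b) (hd : 0 < d) :
    ∫ x in (0 : ℝ)..d, x ^ (a - 1) * (d - x) ^ (b - 1) =
      d ^ (a + b - 1) * (Real.Gamma a * Real.Gamma b / Real.Gamma (a + b)) := by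
  have h := Complex.betaIntegral_scaled a b hd
  have hβ := Complex.Gamma_mul_Gamma_eq_betaIntegral (s := a) (t := b) (by simpa) (by simpa)
  have hΓ : Real.Gamma (a + b) ≠ 0 := (Real.Gamma_pos_of_pos (add_pos ha hb)).ne'
  have hβ' : Complex.betaIntegral a b =
      ((Real.Gamma a * Real.Gamma b / Real.Gamma (a + b) : ℝ) : ℂ) := by
    rw [← Complex.ofReal_add, Complex.Gamma_ofReal, Complex.Gamma_ofReal, Complex.Gamma_ofReal] at hβ
    push_cast
    rw [hβ, mul_div_cancel_left₀]
    exact_mod_cast hΓ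
  rw [hβ'] at h
  apply Complex.ofReal_injective
  rw [← intervalIntegral.integral_ofReal]
  convert! h using 1
  · refine intervalIntegral.integral_congr fun x hx => ?_
    rw [uIcc_of_le hd.le] at hx
    simp only [Complex.ofReal_mul]
    rw [Complex.ofReal_cpow hx.1, Complex.ofReal_cpow (sub_nonneg.2 hx.2)]
    push_cast
    rfl
  · rw [Complex.ofReal_mul, Complex.ofReal_cpow hd.le]
    push_cast
    rfl

lemma integral_sub_rpow_mul_sub_rpow {a b r t : ℝ} (ha : 0 < a) (hb : 0 < b) (hrt : r < t) :
    ∫ s in r..t, (t - s) ^ (a - 1) * (s - r) ^ (b - 1) =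
      (t - r) ^ (a + b - 1) * (Real.Gamma a * Real.Gamma b / Real.Gamma (a + b)) := by
  rw [← integral_rpow_mul_sub_rpow ha hb (sub_pos.2 hrt)]
  have := intervalIntegral.integral_comp_sub_left (a := r) (b := t)
    (fun x : ℝ => x ^ (a - 1) * (t - r - x) ^ (b - 1)) t
  simp only [sub_self] at this
  rw [← this]
  congr 1
  ext s
  ring_nf

lemma intervalIntegrable_sub_rpow_mul_sub_rpow {a b r t : ℝ} (ha : 0 < a) (hb : 0 < b)
    (hrt : r < t) :
    IntervalIntegrable (fun s => (t - s) ^ (a - 1) * (s - r) ^ (b - 1)) volume r t := by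
  -- The integral of a non-integrable function is `0` by convention, whereas the Beta value is
  -- positive.
  apply intervalIntegral.intervalIntegrable_of_integral_ne_zero
  rw [integral_sub_rpow_mul_sub_rpow ha hb hrt]
  have := Real.Gamma_pos_of_pos ha
  have := Real.Gamma_pos_of_pos hb
  have := Real.Gamma_pos_of_pos (add_pos ha hb)
  have := Real.rpow_pos_of_pos (sub_pos.2 hrt) (a + b - 1)
  positivity

/-- The integrand of the iterated Riemann-Liouville integral on the square. -/
def iteratedKernel (a b t : ℝ) (h : ℝ → ℝ) (z : ℝ × ℝ) : ℝ :=
  (Ioi z.2).indicator (fun s => (t - s) ^ (a - 1) * (s - z.2) ^ (b - 1)) z.1 * h z.2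

lemma setIntegral_Ioc_indicator_Ioi {t r : ℝ} (hr : r ∈ Ioc 0 t) (k : ℝ → ℝ) :
    ∫ s in Ioc 0 t, (Ioi r).indicator k s = ∫ s in r..t, k s := by
  rw [setIntegral_indicator measurableSet_Ioi, intervalIntegral.integral_of_le hr.2]
  congr 2
  ext s
  simp only [mem_inter_iff, mem_Ioc, mem_Ioi]
  constructor
  · rintro ⟨⟨_, h⟩, h'⟩; exact ⟨h', h⟩
  · rintro ⟨h, h'⟩; exact ⟨⟨hr.1.trans h, h'⟩, h⟩

lemma integrableOn_Ioc_indicator_Ioi {t r : ℝ} (hr : r ∈ Ioc 0 t) {k : ℝ → ℝ}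
    (hk : IntervalIntegrable k volume r t) :
    IntegrableOn ((Ioi r).indicator k) (Ioc 0 t) := by
  rw [intervalIntegrable_iff_integrableOn_Ioc_of_le hr.2] at hk
  rw [integrableOn_indicator_iff measurableSet_Ioi]
  refine hk.mono_set ?_
  rintro s ⟨h, h'⟩
  exact ⟨h, h'.2⟩

lemma norm_iteratedKernel {a b t : ℝ} {h : ℝ → ℝ} {s r : ℝ} (hs : s ≤ t) :
    ‖iteratedKernel a b t h (s, r)‖ = iteratedKernel a b t (fun r => ‖h r‖) (s, r) := by
  unfold iteratedKernel
  rw [norm_mul, Real.norm_of_nonneg]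
  exact indicator_apply_nonneg fun hrs => mul_nonneg (Real.rpow_nonneg (sub_nonneg.2 hs) _)
    (Real.rpow_nonneg (sub_nonneg.2 (le_of_lt hrs)) _)

lemma integral_iteratedKernel_left {a b t r : ℝ} (ha : 0 < a) (hb : 0 < b) (h : ℝ → ℝ)
    (hr : r ∈ Ioo 0 t) :
    ∫ s in Ioc 0 t, iteratedKernel a b t h (s, r) =
      (t - r) ^ (a + b - 1) * (Real.Gamma a * Real.Gamma b / Real.Gamma (a + b)) * h r := by
  simp only [iteratedKernel]
  rw [integral_mul_const, setIntegral_Ioc_indicator_Ioi (Ioo_subset_Ioc_self hr),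
    integral_sub_rpow_mul_sub_rpow ha hb hr.2]

lemma integral_iteratedKernel_right {a b t s : ℝ} (h : ℝ → ℝ) (hs : s ∈ Ioc 0 t) :
    ∫ r in Ioc 0 t, iteratedKernel a b t h (s, r) =
      (t - s) ^ (a - 1) * ∫ r in (0 : ℝ)..s, (s - r) ^ (b - 1) * h r := by
  have : ∀ r, iteratedKernel a b t h (s, r) =
      (Iio s).indicator (fun r => (t - s) ^ (a - 1) * ((s - r) ^ (b - 1) * h r)) r := by
    intro r
    by_cases hrs : r < s
    · simp [iteratedKernel, hrs, mul_assoc]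
    · simp [iteratedKernel, hrs]
  simp_rw [this]
  rw [setIntegral_indicator measurableSet_Iio, integral_const_mul,
    intervalIntegral.integral_of_le hs.1.le, integral_Ioc_eq_integral_Ioo]
  congr 3
  ext r
  simp only [mem_inter_iff, mem_Ioc, mem_Iio, mem_Ioo]
  constructor
  · rintro ⟨⟨h, _⟩, h'⟩; exact ⟨h, h'⟩
  · rintro ⟨h, h'⟩; exact ⟨⟨h, h'.le.trans hs.2⟩, h'⟩

lemma aestronglyMeasurable_iteratedKernel {a b t : ℝ} {h : ℝ → ℝ}
    (hh : AEStronglyMeasurable h (volume.restrict (Ioc 0 t))) :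
    AEStronglyMeasurable (iteratedKernel a b t h)
      ((volume.restrict (Ioc 0 t)).prod (volume.restrict (Ioc 0 t))) := by
  unfold iteratedKernel
  refine AEStronglyMeasurable.mul (Measurable.aestronglyMeasurable ?_) hh.comp_snd
  have : (fun z : ℝ × ℝ =>
      (Ioi z.2).indicator (fun s => (t - s) ^ (a - 1) * (s - z.2) ^ (b - 1)) z.1) =
      {z : ℝ × ℝ | z.2 < z.1}.indicator
        (fun z => (t - z.1) ^ (a - 1) * (z.1 - z.2) ^ (b - 1)) := by
    ext z
    by_cases hz : z.2 < z.1 <;> simp [hz]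
  rw [this]
  exact Measurable.indicator (by fun_prop) (measurableSet_lt measurable_snd measurable_fst)

lemma intervalIntegrable_sub_rpow_mul {a t : ℝ} (ha : 0 ≤ a) {h : ℝ → ℝ}
    (hh : IntervalIntegrable h volume 0 t) (c : ℝ) :
    IntervalIntegrable (fun r => (t - r) ^ a * c * h r) volume 0 t := by
  refine hh.continuousOn_mul (Continuous.continuousOn ?_)
  exact (Continuous.rpow_const (by fun_prop) fun _ => Or.inr ha).mul continuous_const

/-- Tonelli: integrating first in the outer time variable leaves the weight `(t - r)^(a+b-1)`, which
is bounded because `1 ≤ a + b`. Integrability of `h` is then enough. -/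
lemma integrable_iteratedKernel {a b t : ℝ} (ha : 0 < a) (hb : 0 < b) (hab : 1 ≤ a + b)
    (ht : 0 ≤ t) {h : ℝ → ℝ} (hh : IntervalIntegrable h volume 0 t) :
    Integrable (iteratedKernel a b t h)
      ((volume.restrict (Ioc 0 t)).prod (volume.restrict (Ioc 0 t))) := by
  have hh' := (intervalIntegrable_iff_integrableOn_Ioc_of_le ht).1 hh
  have hIoo : ∀ᵐ r ∂(volume.restrict (Ioc 0 t)), r ∈ Ioo 0 t := by
    rw [← restrict_Ioo_eq_restrict_Ioc]
    exact ae_restrict_mem measurableSet_Ioo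
  rw [integrable_prod_iff' (aestronglyMeasurable_iteratedKernel hh'.aestronglyMeasurable)]
  constructor
  · filter_upwards [hIoo] with r hr
    exact (integrableOn_Ioc_indicator_Ioi (Ioo_subset_Ioc_self hr)
      (intervalIntegrable_sub_rpow_mul_sub_rpow ha hb hr.2)).mul_const (h r)
  · have h2 := intervalIntegrable_sub_rpow_mul (a := a + b - 1) (by linarith) hh.norm
      (Real.Gamma a * Real.Gamma b / Real.Gamma (a + b))
    rw [intervalIntegrable_iff_integrableOn_Ioc_of_le ht] at h2
    refine h2.congr ?_
    filter_upwards [hIoo] with r hr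
    rw [← integral_iteratedKernel_left ha hb (fun r => ‖h r‖) hr]
    refine setIntegral_congr_fun measurableSet_Ioc fun s hs => ?_
    exact (norm_iteratedKernel hs.2).symm

lemma intervalIntegrable_rlIntegral {a b t : ℝ} (ha : 0 < a) (hb : 0 < b) (hab : 1 ≤ a + b)
    (ht : 0 ≤ t) {h : ℝ → ℝ} (hh : IntervalIntegrable h volume 0 t) :
    IntervalIntegrable (fun s => (t - s) ^ (a - 1) * rlIntegral b h s) volume 0 t := by
  rw [intervalIntegrable_iff_integrableOn_Ioc_of_le ht]
  have := (integrable_iteratedKernel ha hb hab ht hh).integral_prod_left.const_mul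
    (Real.Gamma b)⁻¹
  refine this.congr ?_
  filter_upwards [ae_restrict_mem measurableSet_Ioc] with s hs
  rw [integral_iteratedKernel_right h hs, rlIntegral, if_neg hb.ne']
  ring

/-- Semigroup property of the Riemann-Liouville fractional integrals. -/
lemma rlIntegral_rlIntegral {a b t : ℝ} (ha : 0 < a) (hb : 0 < b) (hab : 1 ≤ a + b)
    (ht : 0 ≤ t) {h : ℝ → ℝ} (hh : IntervalIntegrable h volume 0 t) :
    rlIntegral a (rlIntegral b h) t = rlIntegral (a + b) h t := by
  have hswap := integral_integral_swap (f := fun s r => iteratedKernel a b t h (s, r))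
    (integrable_iteratedKernel ha hb hab ht hh)
  have h1 : ∫ s in Ioc 0 t, ∫ r in Ioc 0 t, iteratedKernel a b t h (s, r) =
      Real.Gamma b * ∫ s in (0 : ℝ)..t, (t - s) ^ (a - 1) * rlIntegral b h s := by
    rw [intervalIntegral.integral_of_le ht, ← integral_const_mul]
    refine setIntegral_congr_fun measurableSet_Ioc fun s hs => ?_
    have := (Real.Gamma_pos_of_pos hb).ne'
    simp only [integral_iteratedKernel_right h hs, rlIntegral, if_neg hb.ne']
    field_simp
  have h2 : ∫ r in Ioc 0 t, ∫ s in Ioc 0 t, iteratedKernel a b t h (s, r) =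
      (Real.Gamma a * Real.Gamma b / Real.Gamma (a + b)) *
        ∫ r in (0 : ℝ)..t, (t - r) ^ (a + b - 1) * h r := by
    rw [intervalIntegral.integral_of_le ht, ← integral_const_mul, integral_Ioc_eq_integral_Ioo,
      integral_Ioc_eq_integral_Ioo]
    refine setIntegral_congr_fun measurableSet_Ioo fun r hr => ?_
    simp only [integral_iteratedKernel_left ha hb h hr]
    ring
  rw [h1, h2] at hswap
  have := (Real.Gamma_pos_of_pos ha).ne'
  have := (Real.Gamma_pos_of_pos hb).ne'
  have := (Real.Gamma_pos_of_pos (add_pos ha hb)).ne'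
  rw [rlIntegral, if_neg ha.ne', rlIntegral, if_neg (add_pos ha hb).ne']
  field_simp at hswap ⊢
  linear_combination hswap

lemma rlIntegral_one (h : ℝ → ℝ) (t : ℝ) : rlIntegral 1 h t = ∫ s in (0 : ℝ)..t, h s := by
  simp [rlIntegral]

/-! ### Convolution with a locally integrable operator kernel. -/

section Volterra

lemma exists_norm_le_of_continuousOn_Icc {X : Type*} [NormedAddCommGroup X] {g : ℝ → X} {T : ℝ} (hg : ContinuousOn g (Icc 0 T)) :
    ∃ M, ∀ s ∈ Icc 0 T, ‖g s‖ ≤ M :=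
  isCompact_Icc.exists_bound_of_continuousOn hg
variable {X : Type*} [NormedAddCommGroup X] [NormedSpace ℝ X]

/-- The Volterra convolution `∫₀ᵗ K(t - s) g(s) ds`. -/
def volterra (K : ℝ → X →L[ℝ] X) (g : ℝ → X) (t : ℝ) : X :=
  ∫ s in (0 : ℝ)..t, K (t - s) (g s)

lemma volterra_eq_integral_comp_sub (K : ℝ → X →L[ℝ] X) (g : ℝ → X) (t : ℝ) :
    volterra K g t = ∫ r in (0 : ℝ)..t, K r (g (t - r)) := by
  have := intervalIntegral.integral_comp_sub_left (a := 0) (b := t)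
    (fun r => K r (g (t - r))) t
  simpa [volterra] using this

lemma volterra_congr {K : ℝ → X →L[ℝ] X} {g₁ g₂ : ℝ → X} {t : ℝ} (ht : 0 ≤ t)
    (h : EqOn g₁ g₂ (Ico 0 t)) : volterra K g₁ t = volterra K g₂ t := by
  rw [volterra, volterra, intervalIntegral.integral_of_le ht, intervalIntegral.integral_of_le ht,
    integral_Ioc_eq_integral_Ioo, integral_Ioc_eq_integral_Ioo]
  exact setIntegral_congr_fun measurableSet_Ioo fun s hs => by
    simp only [h (Ioo_subset_Ico_self hs)]

lemma aestronglyMeasurable_clm_apply {β : Type*} [MeasurableSpace β] {μ : Measure β}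
    {K : β → X →L[ℝ] X} {g : β → X} (hK : AEStronglyMeasurable K μ)
    (hg : AEStronglyMeasurable g μ) : AEStronglyMeasurable (fun s => K s (g s)) μ :=
  (ContinuousLinearMap.id ℝ (X →L[ℝ] X)).aestronglyMeasurable_comp₂ hK hg

lemma intervalIntegrable_kernel_sub {K : ℝ → X →L[ℝ] X}
    (hK : ∀ T, 0 ≤ T → IntervalIntegrable K volume 0 T) {t : ℝ} (ht : 0 ≤ t) :
    IntervalIntegrable (fun s => K (t - s)) volume 0 t := by
  simpa using ((hK t ht).comp_sub_left t).symm

lemma intervalIntegrable_kernel_apply {K : ℝ → X →L[ℝ] X}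
    (hK : ∀ T, 0 ≤ T → IntervalIntegrable K volume 0 T) {t : ℝ} (ht : 0 ≤ t) {g : ℝ → X}
    (hg : ContinuousOn g (Ico 0 t)) {M : ℝ} (hM : ∀ s ∈ Ico 0 t, ‖g s‖ ≤ M) :
    IntervalIntegrable (fun s => K (t - s) (g s)) volume 0 t := by
  have hK' := intervalIntegrable_kernel_sub hK ht
  rw [intervalIntegrable_iff_integrableOn_Ioo_of_le ht] at hK' ⊢
  refine (hK'.norm.mul_const M).mono' (aestronglyMeasurable_clm_apply hK'.aestronglyMeasurable
    ((hg.mono Ioo_subset_Ico_self).aestronglyMeasurable measurableSet_Ioo)) ?_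
  filter_upwards [ae_restrict_mem measurableSet_Ioo] with s hs
  exact ((K (t - s)).le_opNorm _).trans
    (mul_le_mul_of_nonneg_left (hM s (Ioo_subset_Ico_self hs)) (norm_nonneg _))

lemma intervalIntegrable_kernel_apply_of_continuousOn {K : ℝ → X →L[ℝ] X}
    (hK : ∀ T, 0 ≤ T → IntervalIntegrable K volume 0 T) {t : ℝ} (ht : 0 ≤ t) {g : ℝ → X}
    (hg : ContinuousOn g (Icc 0 t)) :
    IntervalIntegrable (fun s => K (t - s) (g s)) volume 0 t := by
  obtain ⟨M, hM⟩ := exists_norm_le_of_continuousOn_Icc hg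
  exact intervalIntegrable_kernel_apply hK ht (hg.mono Ico_subset_Icc_self)
    fun s hs => hM s (Ico_subset_Icc_self hs)

/-- The integrands agree up to `τ`, and for `τ ≤ s ≤ t ≤ τ + δ` the kernel is evaluated at `t - s ∈
[0, δ]`. Only the mass of `K` near its singularity counts, whatever the length of the past. -/
lemma norm_volterra_sub_volterra_le {K : ℝ → X →L[ℝ] X}
    (hK : ∀ T, 0 ≤ T → IntervalIntegrable K volume 0 T) {τ δ M t : ℝ} (hτ : 0 ≤ τ) (hδ : 0 ≤ δ)
    (hM0 : 0 ≤ M) {g₁ g₂ : ℝ → X}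
    (hg₁ : ContinuousOn g₁ (Icc 0 (τ + δ))) (hg₂ : ContinuousOn g₂ (Icc 0 (τ + δ)))
    (heq : EqOn g₁ g₂ (Icc 0 τ)) (hM : ∀ s ∈ Icc τ (τ + δ), ‖g₁ s - g₂ s‖ ≤ M)
    (ht : t ∈ Icc 0 (τ + δ)) :
    ‖volterra K g₁ t - volterra K g₂ t‖ ≤ (∫ r in (0 : ℝ)..δ, ‖K r‖) * M := by
  have hκ : 0 ≤ ∫ r in (0 : ℝ)..δ, ‖K r‖ :=
    intervalIntegral.integral_nonneg hδ fun _ _ => norm_nonneg _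
  rcases le_total t τ with h | h
  · rw [volterra_congr ht.1 fun s hs => heq ⟨hs.1, hs.2.le.trans h⟩, sub_self, norm_zero]
    positivity
  have hi₁ := intervalIntegrable_kernel_apply_of_continuousOn hK ht.1
    (hg₁.mono (Icc_subset_Icc_right ht.2))
  have hi₂ := intervalIntegrable_kernel_apply_of_continuousOn hK ht.1
    (hg₂.mono (Icc_subset_Icc_right ht.2))
  have hi := hi₁.sub hi₂
  have hτt : uIcc 0 τ ⊆ uIcc 0 t := by
    rw [uIcc_of_le hτ, uIcc_of_le ht.1]; exact Icc_subset_Icc_right h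
  have hτt' : uIcc τ t ⊆ uIcc 0 t := by
    rw [uIcc_of_le h, uIcc_of_le ht.1]; exact Icc_subset_Icc_left hτ
  rw [volterra, volterra, ← intervalIntegral.integral_sub hi₁ hi₂,
    ← intervalIntegral.integral_add_adjacent_intervals (hi.mono_set hτt) (hi.mono_set hτt'),
    intervalIntegral.integral_congr (g := fun _ => (0 : X)), intervalIntegral.integral_zero,
    zero_add]
  · have hnK : IntervalIntegrable (fun s => ‖K (t - s)‖) volume τ t :=
      ((intervalIntegrable_kernel_sub hK ht.1).mono_set hτt').norm
    calc _ ≤ ∫ s in τ..t, ‖K (t - s)‖ * M := by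
          refine intervalIntegral.norm_integral_le_of_norm_le h (ae_of_all _ fun s hs => ?_)
            (hnK.mul_const M)
          rw [← map_sub]
          exact ((K (t - s)).le_opNorm _).trans
            (mul_le_mul_of_nonneg_left (hM s ⟨hs.1.le, hs.2.trans ht.2⟩) (norm_nonneg _))
      _ = (∫ r in (0 : ℝ)..(t - τ), ‖K r‖) * M := by
          rw [intervalIntegral.integral_mul_const]
          have := intervalIntegral.integral_comp_sub_left (a := τ) (b := t)
            (fun r => ‖K r‖) t
          rw [this, sub_self]
      _ ≤ _ := by
          refine mul_le_mul_of_nonneg_right ?_ hM0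
          exact intervalIntegral.integral_mono_interval le_rfl (sub_nonneg.2 h)
            (by linarith [ht.2]) (ae_of_all _ fun _ => norm_nonneg _) (hK δ hδ).norm
  · intro s hs
    rw [uIcc_of_le hτ] at hs
    simp [heq hs]

lemma exists_integral_norm_kernel_le {K : ℝ → X →L[ℝ] X}
    (hK : ∀ T, 0 ≤ T → IntervalIntegrable K volume 0 T) {ε : ℝ} (hε : 0 < ε) :
    ∀ᶠ δ in 𝓝[>] (0 : ℝ), ∫ r in (0 : ℝ)..δ, ‖K r‖ ≤ ε := by
  have hc : ContinuousOn (fun δ => ∫ r in (0 : ℝ)..δ, ‖K r‖) (uIcc 0 1) :=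
    intervalIntegral.continuousOn_primitive_interval' (hK 1 zero_le_one).norm left_mem_uIcc
  have h0 := hc 0 left_mem_uIcc
  rw [uIcc_of_le zero_le_one] at h0
  have h1 : Tendsto (fun δ => ∫ r in (0 : ℝ)..δ, ‖K r‖) (𝓝[>] 0) (𝓝 0) := by
    have := h0.tendsto
    rw [intervalIntegral.integral_same] at this
    exact this.mono_left (nhdsWithin_le_of_mem (Icc_mem_nhdsGT one_pos))
  exact (h1.eventually (gt_mem_nhds hε)).mono fun _ h => h.le

/-- Boundedness on `[0, T)` suffices for continuity up to `T`; this is what extends bounded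
solutions to the end point. -/
lemma continuousOn_volterra {K : ℝ → X →L[ℝ] X}
    (hK : ∀ T, 0 ≤ T → IntervalIntegrable K volume 0 T) {T : ℝ} (hT : 0 ≤ T) {g : ℝ → X}
    (hg : ContinuousOn g (Ico 0 T)) {M : ℝ} (hM : ∀ s ∈ Ico 0 T, ‖g s‖ ≤ M) :
    ContinuousOn (volterra K g) (Icc 0 T) := by
  rcases hT.eq_or_lt with rfl | hT0
  · simp
  have hM0 : 0 ≤ M := (norm_nonneg _).trans (hM 0 ⟨le_rfl, hT0⟩)
  set g₀ : ℝ → X := (Ico 0 T).indicator g with hg₀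
  have hmeas : AEStronglyMeasurable g₀ volume :=
    (aestronglyMeasurable_indicator_iff measurableSet_Ico).2
      (hg.aestronglyMeasurable measurableSet_Ico)
  have hbd : ∀ s, ‖g₀ s‖ ≤ M := fun s => by
    by_cases hs : s ∈ Ico 0 T
    · simpa [hg₀, hs] using hM s hs
    · simpa [hg₀, hs] using hM0
  have hcont : ∀ s, s ≠ 0 → s ≠ T → ContinuousAt g₀ s := fun s h0 h1 => by
    by_cases hs : s ∈ Ioo 0 T
    · have : g₀ =ᶠ[𝓝 s] g := by
        filter_upwards [Ioo_mem_nhds hs.1 hs.2] with r hr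
        simp [hg₀, Ioo_subset_Ico_self hr]
      exact (hg.continuousAt (Ico_mem_nhds hs.1 hs.2)).congr this.symm
    · have hs' : s ∈ (Icc 0 T)ᶜ := fun h =>
        hs ⟨lt_of_le_of_ne h.1 h0.symm, lt_of_le_of_ne h.2 h1⟩
      have : g₀ =ᶠ[𝓝 s] fun _ => 0 := by
        filter_upwards [isClosed_Icc.isOpen_compl.mem_nhds hs'] with r hr
        exact indicator_of_notMem (fun h => hr (Ico_subset_Icc_self h)) _
      exact continuousAt_const.congr this.symm
  have hKT := (intervalIntegrable_iff_integrableOn_Ioc_of_le hT).1 (hK T hT)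
  -- Extending `g` by zero fixes the limits of integration. Dominated convergence applies since `g₀`
  -- can jump only at `0` and `T`, which `t₀ - r` avoids for almost every `r`.
  have key : Continuous fun t => ∫ r in (0 : ℝ)..T, K r (g₀ (t - r)) := by
    rw [continuous_iff_continuousAt]
    intro t₀
    refine intervalIntegral.continuousAt_of_dominated_interval (bound := fun r => ‖K r‖ * M)
      (Eventually.of_forall fun t => ?_) (Eventually.of_forall fun t => ae_of_all _ fun r _ => ?_)
      ((hK T hT).norm.mul_const M) ?_
    · rw [uIoc_of_le hT]
      refine aestronglyMeasurable_clm_apply hKT.aestronglyMeasurable ?_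
      exact (hmeas.comp_quasiMeasurePreserving
        (quasiMeasurePreserving_sub_left volume t)).restrict
    · exact ((K r).le_opNorm _).trans (mul_le_mul_of_nonneg_left (hbd _) (norm_nonneg _))
    · have h0 : ∀ᵐ r : ℝ, r ≠ t₀ := Measure.ae_ne volume t₀
      have h1 : ∀ᵐ r : ℝ, r ≠ t₀ - T := Measure.ae_ne volume _
      filter_upwards [h0, h1] with r hr0 hr1 _
      have : ContinuousAt (fun t => g₀ (t - r)) t₀ :=
        ContinuousAt.comp (g := g₀) (hcont (t₀ - r) (sub_ne_zero.2 hr0.symm)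
          fun h => hr1 (by linarith)) (by fun_prop)
      exact (K r).continuous.continuousAt.comp this
  refine key.continuousOn.congr fun t ht => ?_
  change _ = ∫ r in (0 : ℝ)..T, K r (g₀ (t - r))
  rw [volterra_congr (g₂ := g₀) ht.1 fun s hs => by
    simp [hg₀, show s ∈ Ico 0 T from ⟨hs.1, hs.2.trans_le ht.2⟩], volterra_eq_integral_comp_sub,
    intervalIntegral.integral_of_le ht.1, intervalIntegral.integral_of_le hT]
  symm
  refine setIntegral_eq_of_subset_of_forall_sdiff_eq_zero measurableSet_Ioc
    (Ioc_subset_Ioc_right ht.2) fun r hr => ?_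
  have : t - r ∉ Ico 0 T := fun h => hr.2 ⟨hr.1.1, by linarith [h.1]⟩
  simp [hg₀, this]

lemma continuousOn_volterra_of_continuousOn {K : ℝ → X →L[ℝ] X}
    (hK : ∀ T, 0 ≤ T → IntervalIntegrable K volume 0 T) {T : ℝ} (hT : 0 ≤ T) {g : ℝ → X}
    (hg : ContinuousOn g (Icc 0 T)) : ContinuousOn (volterra K g) (Icc 0 T) := by
  obtain ⟨M, hM⟩ := exists_norm_le_of_continuousOn_Icc hg
  exact continuousOn_volterra hK hT (hg.mono Ico_subset_Icc_self)
    fun s hs => hM s (Ico_subset_Icc_self hs)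

end Volterra

/-! ### The nonlinear Volterra equation: uniqueness, extension, continuation. -/

section VolterraEquation

lemma continuousOn_comp_of_continuousOn_uncurry {X : Type*} [NormedAddCommGroup X]
    {F : ℝ → X → X}
    (hF : ContinuousOn (Function.uncurry F) (Ici 0 ×ˢ univ)) {s : Set ℝ} (hs : s ⊆ Ici 0)
    {φ : ℝ → X} (hφ : ContinuousOn φ s) : ContinuousOn (fun t => F t (φ t)) s :=
  hF.comp (continuousOn_id.prodMk hφ) fun _ ht => ⟨hs ht, mem_univ _⟩

variable {X : Type*} [NormedAddCommGroup X] [NormedSpace ℝ X]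

/-- `φ` is a continuous solution on `[0, T]` of `φ(t) = u₀ + ∫₀ᵗ K(t - s) F(s, φ(s)) ds`. -/
structure IsVolterraSolution (K : ℝ → X →L[ℝ] X) (F : ℝ → X → X) (u₀ : X) (T : ℝ)
    (φ : ℝ → X) : Prop where
  continuousOn : ContinuousOn φ (Icc 0 T)
  eq : ∀ t ∈ Icc 0 T, φ t = u₀ + volterra K (fun s => F s (φ s)) t

variable {K : ℝ → X →L[ℝ] X} {F : ℝ → X → X} {u₀ : X}

lemma IsVolterraSolution.mono {T T' : ℝ} {φ : ℝ → X} (h : IsVolterraSolution K F u₀ T' φ)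
    (hT : T ≤ T') : IsVolterraSolution K F u₀ T φ :=
  ⟨h.continuousOn.mono (Icc_subset_Icc_right hT), fun t ht => h.eq t ⟨ht.1, ht.2.trans hT⟩⟩

lemma IsVolterraSolution.congr {T : ℝ} {φ ψ : ℝ → X} (h : IsVolterraSolution K F u₀ T φ)
    (heq : EqOn ψ φ (Icc 0 T)) : IsVolterraSolution K F u₀ T ψ := by
  refine ⟨h.continuousOn.congr heq, fun t ht => ?_⟩
  rw [heq ht, h.eq t ht]
  congr 1
  exact volterra_congr ht.1 fun s hs => by
    simp only [heq ⟨hs.1, hs.2.le.trans ht.2⟩]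

lemma IsVolterraSolution.initial {T : ℝ} (hT : 0 ≤ T) {φ : ℝ → X}
    (h : IsVolterraSolution K F u₀ T φ) : φ 0 = u₀ := by
  simpa [volterra] using h.eq 0 ⟨le_rfl, hT⟩

lemma isVolterraSolution_zero : IsVolterraSolution K F u₀ 0 fun _ => u₀ := by
  refine ⟨continuousOn_const, fun t ht => ?_⟩
  obtain rfl : t = 0 := le_antisymm ht.2 ht.1
  simp [volterra]

/-- Uniqueness for the Volterra equation. -/
lemma IsVolterraSolution.eqOn (hK : ∀ T, 0 ≤ T → IntervalIntegrable K volume 0 T)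
    (hF : ContinuousOn (Function.uncurry F) (Ici 0 ×ˢ univ)) (hL : LocallyLipschitzSnd F)
    {T : ℝ} {φ ψ : ℝ → X} (hφ : IsVolterraSolution K F u₀ T φ)
    (hψ : IsVolterraSolution K F u₀ T ψ) : EqOn φ ψ (Icc 0 T) := by
  rcases lt_or_ge T 0 with hT | hT
  · simp [Icc_eq_empty_of_lt hT]
  have hsub : ContinuousOn (fun t => φ t - ψ t) (Icc 0 T) := hφ.continuousOn.sub hψ.continuousOn
  have hcl : IsClosed ({t | φ t = ψ t} ∩ Icc 0 T) := by
    have := hsub.preimage_isClosed_of_isClosed isClosed_Icc (isClosed_singleton (x := (0 : X)))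
    rw [inter_comm]
    convert! this using 2
    ext t
    simp [sub_eq_zero]
  -- The agreement set is closed and contains `0`, so it is enough to propagate agreement slightly
  -- to the right of each `t₀`.
  refine hcl.Icc_subset_of_forall_mem_nhdsGT_of_Icc_subset
    (by simp [hφ.initial hT, hψ.initial hT]) fun t₀ ht₀ heq => ?_
  obtain ⟨r, hr, L, hLpos, hlip⟩ := hL t₀ ht₀.1 (φ t₀)
  have hκ := exists_integral_norm_kernel_le hK (ε := (2 * L)⁻¹) (by positivity)
  have hT' : ∀ᶠ δ in 𝓝[>] (0 : ℝ), δ < T - t₀ :=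
    (gt_mem_nhds (sub_pos.2 ht₀.2)).filter_mono nhdsWithin_le_nhds
  have hnear : ∀ {χ : ℝ → X}, ContinuousOn χ (Icc 0 T) → χ t₀ = φ t₀ →
      ∀ᶠ s in 𝓝[≥] t₀, |s - t₀| + ‖χ s - φ t₀‖ < r := by
    intro χ hχ h0
    have h1 : ContinuousWithinAt (fun s => |s - t₀| + ‖χ s - φ t₀‖) (Ici t₀) t₀ := by
      have h2 : ContinuousWithinAt χ (Ici t₀) t₀ :=
        (hχ t₀ ⟨ht₀.1, ht₀.2.le⟩).mono_of_mem_nhdsWithin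
          (mem_of_superset (Icc_mem_nhdsGE ht₀.2) (Icc_subset_Icc_left ht₀.1))
      exact ContinuousWithinAt.add (by fun_prop) (h2.sub continuousWithinAt_const).norm
    exact h1.tendsto.eventually (gt_mem_nhds (by simpa [h0] using hr))
  have hφψ : φ t₀ = ψ t₀ := heq ⟨ht₀.1, le_rfl⟩
  obtain ⟨ρ, hρ, hρs⟩ := mem_nhdsGE_iff_exists_Ico_subset.1
    ((hnear hφ.continuousOn rfl).and (hnear hψ.continuousOn hφψ.symm))
  have hρ' : ∀ᶠ δ in 𝓝[>] (0 : ℝ), δ < ρ - t₀ :=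
    (gt_mem_nhds (sub_pos.2 hρ)).filter_mono nhdsWithin_le_nhds
  obtain ⟨δ, hδκ, hδT, hδρ, hδ⟩ :=
    (hκ.and (hT'.and (hρ'.and self_mem_nhdsWithin))).exists
  have hδ : 0 < δ := hδ
  have hsubI : Icc 0 (t₀ + δ) ⊆ Icc 0 T := Icc_subset_Icc_right (by linarith)
  -- At a maximum point of the difference on `[t₀, t₀ + δ]`, the choice `∫₀^δ ‖K‖ ≤ 1/(2L)` gives `M
  -- ≤ M/2`.
  obtain ⟨s₀, hs₀, hmax⟩ := isCompact_Icc.exists_isMaxOn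
    (nonempty_Icc.2 (show t₀ ≤ t₀ + δ by linarith))
    ((hsub.mono ((Icc_subset_Icc_left ht₀.1).trans hsubI)).norm)
  set M := ‖φ s₀ - ψ s₀‖ with hMdef
  have hbound : ∀ s ∈ Icc t₀ (t₀ + δ), ‖φ s - ψ s‖ ≤ M := fun s hs => hmax hs
  have hle : M ≤ (∫ r in (0 : ℝ)..δ, ‖K r‖) * (L * M) := by
    have h := norm_volterra_sub_volterra_le hK ht₀.1 hδ.le (M := L * M) (t := s₀)
      (g₁ := fun s => F s (φ s)) (g₂ := fun s => F s (ψ s)) (by positivity)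
      (continuousOn_comp_of_continuousOn_uncurry hF Icc_subset_Ici_self
        (hφ.continuousOn.mono hsubI))
      (continuousOn_comp_of_continuousOn_uncurry hF Icc_subset_Ici_self
        (hψ.continuousOn.mono hsubI))
      (fun s hs => by simp only [show φ s = ψ s from heq hs])
      (fun s hs => by
        have := hρs (show s ∈ Ico t₀ ρ from ⟨hs.1, by linarith [hs.2]⟩)
        exact (hlip s (ht₀.1.trans hs.1) _ _ this.1 this.2).trans
          (mul_le_mul_of_nonneg_left (hbound s hs) hLpos.le))
      ⟨ht₀.1.trans hs₀.1, hs₀.2⟩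
    have hs₀T := hsubI ⟨ht₀.1.trans hs₀.1, hs₀.2⟩
    have he : φ s₀ - ψ s₀ = volterra K (fun s => F s (φ s)) s₀ -
        volterra K (fun s => F s (ψ s)) s₀ := by
      rw [hφ.eq s₀ hs₀T, hψ.eq s₀ hs₀T]; abel
    rwa [← he] at h
  have hM0 : M = 0 := by
    have h1 : (∫ r in (0 : ℝ)..δ, ‖K r‖) * (L * M) ≤ (2 * L)⁻¹ * (L * M) :=
      mul_le_mul_of_nonneg_right hδκ (by positivity)
    have h2 : (2 * L)⁻¹ * (L * M) = M / 2 := by field_simp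
    have h3 : 0 ≤ M := norm_nonneg _
    linarith
  filter_upwards [Ioc_mem_nhdsGT (show t₀ < t₀ + δ by linarith)] with s hs
  have := hbound s ⟨hs.1.le, hs.2⟩
  rw [hM0] at this
  exact sub_eq_zero.1 (norm_le_zero_iff.1 this)

/-- A solution which is bounded on `[0, ω)` extends to `[0, ω]`. -/
lemma exists_isVolterraSolution_of_bounded
    (hK : ∀ T, 0 ≤ T → IntervalIntegrable K volume 0 T)
    (hF : ContinuousOn (Function.uncurry F) (Ici 0 ×ˢ univ)) (hB : MapsBoundedToBounded F)
    {ω : ℝ} (hω : 0 < ω) {φ : ℝ → X} (hφ : ∀ τ ∈ Ioo 0 ω, IsVolterraSolution K F u₀ τ φ)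
    {C : ℝ} (hC : ∀ t ∈ Ico 0 ω, ‖φ t‖ ≤ C) :
    ∃ ψ, IsVolterraSolution K F u₀ ω ψ ∧ EqOn ψ φ (Ico 0 ω) := by
  have hmem : ∀ t ∈ Ico 0 ω, ∃ τ ∈ Ioo 0 ω, t ∈ Ico 0 τ := fun t ht =>
    ⟨(t + ω) / 2, ⟨by linarith [ht.1], by linarith [ht.2]⟩, ht.1, by linarith [ht.2]⟩
  have hcont : ContinuousOn φ (Ico 0 ω) := fun t ht => by
    obtain ⟨τ, hτ, htτ⟩ := hmem t ht
    refine ((hφ τ hτ).continuousOn t ⟨htτ.1, htτ.2.le⟩).mono_of_mem_nhdsWithin ?_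
    filter_upwards [self_mem_nhdsWithin, nhdsWithin_le_nhds (Iio_mem_nhds htτ.2)] with s hs hs'
    exact ⟨hs.1, le_of_lt hs'⟩
  have hbdd := hB (Ico 0 ω ×ˢ Metric.closedBall 0 C) (fun z hz => ⟨hz.1.1, mem_univ _⟩)
    ((Metric.isBounded_Ico 0 ω).prod Metric.isBounded_closedBall)
  obtain ⟨M, hM⟩ := hbdd.exists_norm_le
  have hMF : ∀ s ∈ Ico 0 ω, ‖F s (φ s)‖ ≤ M := fun s hs =>
    hM _ ⟨(s, φ s), ⟨hs, by simpa using hC s hs⟩, rfl⟩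
  have hFc := continuousOn_comp_of_continuousOn_uncurry hF (fun t ht => ht.1) hcont
  have heq : EqOn (fun t => u₀ + volterra K (fun s => F s (φ s)) t) φ (Ico 0 ω) := fun t ht => by
    obtain ⟨τ, hτ, htτ⟩ := hmem t ht
    exact ((hφ τ hτ).eq t ⟨htτ.1, htτ.2.le⟩).symm
  refine ⟨fun t => u₀ + volterra K (fun s => F s (φ s)) t,
    ⟨continuousOn_const.add (continuousOn_volterra hK hω.le hFc hMF), fun t ht => ?_⟩, heq⟩
  -- The extension agrees with `φ` before `ω`, and the convolution does not see the value at the end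
  -- point.
  refine congrArg (u₀ + ·) (volterra_congr ht.1 fun s hs => ?_)
  exact congrArg (F s) (heq ⟨hs.1, hs.2.trans_le ht.2⟩).symm

/-- A solution on `[0, τ]` can be continued to a larger interval. -/
lemma exists_isVolterraSolution_continuation [CompleteSpace X]
    (hK : ∀ T, 0 ≤ T → IntervalIntegrable K volume 0 T)
    (hF : ContinuousOn (Function.uncurry F) (Ici 0 ×ˢ univ)) (hL : LocallyLipschitzSnd F)
    {τ : ℝ} (hτ : 0 ≤ τ) {φ : ℝ → X} (hφ : IsVolterraSolution K F u₀ τ φ) :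
    ∃ δ > 0, ∃ ψ, IsVolterraSolution K F u₀ (τ + δ) ψ := by
  obtain ⟨r, hr, L, hLpos, hlip⟩ := hL τ hτ (φ τ)
  -- Half the radius for the values and half for the time: `|s - τ| ≤ δ < ρ` and `‖v - φ τ‖ ≤ ρ`
  -- together stay inside the Lipschitz ball.
  set ρ : ℝ := r / 2 with hρ
  have hρ0 : 0 < ρ := by positivity
  -- the solution, continued by a constant
  set φ₀ : ℝ → X := fun t => φ (max 0 (min t τ)) with hφ₀
  have hφ₀c : Continuous φ₀ := by
    have : Continuous fun t : ℝ => max 0 (min t τ) := by fun_prop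
    exact hφ.continuousOn.comp_continuous this fun t =>
      ⟨le_max_left _ _, max_le hτ (min_le_right _ _)⟩
  have hφ₀l : ∀ t ∈ Icc 0 τ, φ₀ t = φ t := fun t ht => by simp [hφ₀, ht.1, ht.2]
  have hφ₀r : ∀ t, τ ≤ t → φ₀ t = φ τ := fun t ht => by simp [hφ₀, ht, hτ]
  have hPτ : u₀ + volterra K (fun s => F s (φ₀ s)) τ = φ τ := by
    rw [hφ.eq τ ⟨hτ, le_rfl⟩]
    exact congrArg (u₀ + ·) (volterra_congr hτ fun s hs =>
      congrArg (F s) (hφ₀l s (Ico_subset_Icc_self hs)))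
  -- The image of the constant continuation moves by at most `ρ/2`; the contraction estimate
  -- contributes the other `ρ/2` in `hmaps`.
  have hPc : ∀ᶠ δ in 𝓝[>] (0 : ℝ), ∀ t ∈ Icc τ (τ + δ),
      ‖u₀ + volterra K (fun s => F s (φ₀ s)) t - φ τ‖ ≤ ρ / 2 := by
    have hc : ContinuousOn (fun t => u₀ + volterra K (fun s => F s (φ₀ s)) t)
        (Icc 0 (τ + 1)) :=
      continuousOn_const.add (continuousOn_volterra_of_continuousOn hK (by linarith)
        (continuousOn_comp_of_continuousOn_uncurry hF Icc_subset_Ici_self hφ₀c.continuousOn))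
    have hc' : ContinuousWithinAt (fun t => ‖u₀ + volterra K (fun s => F s (φ₀ s)) t - φ τ‖)
        (Ici τ) τ := by
      refine (ContinuousWithinAt.sub ((hc τ ⟨hτ, by linarith⟩).mono_of_mem_nhdsWithin ?_)
        continuousWithinAt_const).norm
      exact mem_of_superset (Icc_mem_nhdsGE (show τ < τ + 1 by linarith))
        (Icc_subset_Icc_left hτ)
    have hev := hc'.tendsto.eventually_lt_const (u := ρ / 2) (by
      rw [hPτ]; simpa using hρ0)
    obtain ⟨c, hc1, hc2⟩ := mem_nhdsGE_iff_exists_Ico_subset.1 hev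
    filter_upwards [Ioo_mem_nhdsGT (sub_pos.2 hc1)] with δ hδ t ht
    exact le_of_lt (hc2 ⟨ht.1, by linarith [ht.2, hδ.2]⟩)
  have hδr : ∀ᶠ δ in 𝓝[>] (0 : ℝ), δ < ρ :=
    (gt_mem_nhds hρ0).filter_mono nhdsWithin_le_nhds
  obtain ⟨δ, hδκ, hδP, hδρ, hδ⟩ := ((exists_integral_norm_kernel_le hK
    (ε := (2 * L)⁻¹) (by positivity)).and (hPc.and (hδr.and self_mem_nhdsWithin))).exists
  have hδ : 0 < δ := hδ
  refine ⟨δ, hδ, ?_⟩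
  have hT : (0 : ℝ) ≤ τ + δ := by positivity
  -- the operator whose fixed point is the continuation
  have hPcont : ∀ h : ℝ → X, ContinuousOn h (Icc 0 (τ + δ)) →
      ContinuousOn (fun t => u₀ + volterra K (fun s => F s (h s)) t) (Icc 0 (τ + δ)) :=
    fun h hh => continuousOn_const.add (continuousOn_volterra_of_continuousOn hK hT
      (continuousOn_comp_of_continuousOn_uncurry hF Icc_subset_Ici_self hh))
  let P : C(Icc 0 (τ + δ), X) → C(Icc 0 (τ + δ), X) := fun h =>
    ⟨fun t => u₀ + volterra K (fun s => F s (IccExtend hT h s)) t,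
      (hPcont _ (h.continuous.Icc_extend' (h := hT)).continuousOn).domRestrict⟩
  -- The past is frozen to `φ`, so that no Lipschitz bound is needed on `[0, τ]`.
  let S : Set C(Icc 0 (τ + δ), X) := {h | ∀ t : Icc 0 (τ + δ),
    ((t : ℝ) ≤ τ → h t = φ t) ∧ (τ ≤ (t : ℝ) → ‖h t - φ τ‖ ≤ ρ)}
  have hScl : IsClosed S := by
    simp only [S, ofPred_forall, ofPred_and]
    refine isClosed_iInter fun t => IsClosed.inter ?_ ?_
    · exact isClosed_iInter fun _ => isClosed_eq (by fun_prop) continuous_const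
    · exact isClosed_iInter fun _ => isClosed_le (by fun_prop) continuous_const
  have hlip' : ∀ s ∈ Icc τ (τ + δ), ∀ v w : X, ‖v - φ τ‖ ≤ ρ → ‖w - φ τ‖ ≤ ρ →
      ‖F s v - F s w‖ ≤ L * ‖v - w‖ := fun s hs v w hv hw => by
    have : |s - τ| ≤ δ := by rw [abs_of_nonneg (by linarith [hs.1])]; linarith [hs.2]
    exact hlip s (hτ.trans hs.1) v w (by linarith) (by linarith)
  have hest : ∀ h₁ h₂ : ℝ → X, Continuous h₁ → Continuous h₂ → EqOn h₁ h₂ (Icc 0 τ) →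
      (∀ s ∈ Icc τ (τ + δ), ‖h₁ s - φ τ‖ ≤ ρ) → (∀ s ∈ Icc τ (τ + δ), ‖h₂ s - φ τ‖ ≤ ρ) →
      ∀ M, 0 ≤ M → (∀ s ∈ Icc τ (τ + δ), ‖h₁ s - h₂ s‖ ≤ M) → ∀ t ∈ Icc 0 (τ + δ),
      ‖volterra K (fun s => F s (h₁ s)) t - volterra K (fun s => F s (h₂ s)) t‖ ≤ M / 2 := by
    intro h₁ h₂ hc₁ hc₂ heq hb₁ hb₂ M hM0 hM t ht
    have h := norm_volterra_sub_volterra_le hK hτ hδ.le (M := L * M) (t := t)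
      (g₁ := fun s => F s (h₁ s)) (g₂ := fun s => F s (h₂ s)) (by positivity)
      (continuousOn_comp_of_continuousOn_uncurry hF Icc_subset_Ici_self hc₁.continuousOn)
      (continuousOn_comp_of_continuousOn_uncurry hF Icc_subset_Ici_self hc₂.continuousOn)
      (fun s hs => congrArg (F s) (heq hs))
      (fun s hs => (hlip' s hs _ _ (hb₁ s hs) (hb₂ s hs)).trans
        (mul_le_mul_of_nonneg_left (hM s hs) hLpos.le)) ht
    have h1 : (∫ r in (0 : ℝ)..δ, ‖K r‖) * (L * M) ≤ (2 * L)⁻¹ * (L * M) :=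
      mul_le_mul_of_nonneg_right hδκ (by positivity)
    have h2 : (2 * L)⁻¹ * (L * M) = M / 2 := by field_simp
    linarith
  have hSl : ∀ h ∈ S, EqOn (IccExtend hT h) φ (Icc 0 τ) := fun h hh t ht => by
    rw [IccExtend_of_mem hT h ⟨ht.1, by linarith [ht.2]⟩]
    exact (hh ⟨t, _⟩).1 ht.2
  have hSr : ∀ h ∈ S, ∀ s ∈ Icc τ (τ + δ), ‖IccExtend hT h s - φ τ‖ ≤ ρ := fun h hh t ht => by
    rw [IccExtend_of_mem hT h ⟨hτ.trans ht.1, ht.2⟩]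
    exact (hh ⟨t, _⟩).2 ht.1
  have hmaps : MapsTo P S S := by
    intro h hh t
    refine ⟨fun htτ => ?_, fun htτ => ?_⟩
    · change u₀ + volterra K (fun s => F s (IccExtend hT h s)) t = φ t
      rw [hφ.eq t ⟨t.2.1, htτ⟩]
      exact congrArg (u₀ + ·) (volterra_congr t.2.1 fun s hs =>
        congrArg (F s) (hSl h hh ⟨hs.1, hs.2.le.trans htτ⟩))
    · change ‖u₀ + volterra K (fun s => F s (IccExtend hT h s)) t - φ τ‖ ≤ ρ
      have h1 := hest (IccExtend hT h) φ₀ (h.continuous.Icc_extend' (h := hT)) hφ₀c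
        (fun s hs => (hSl h hh hs).trans (hφ₀l s hs).symm) (hSr h hh)
        (fun s hs => by simpa [hφ₀r s hs.1] using hρ0.le) ρ hρ0.le
        (fun s hs => by rw [hφ₀r s hs.1]; exact hSr h hh s hs) t t.2
      have h2 := hδP t ⟨htτ, t.2.2⟩
      have h3 : u₀ + volterra K (fun s => F s (IccExtend hT h s)) t - φ τ =
          (volterra K (fun s => F s (IccExtend hT h s)) t -
            volterra K (fun s => F s (φ₀ s)) t) +
          (u₀ + volterra K (fun s => F s (φ₀ s)) t - φ τ) := by abel
      rw [h3]
      exact (norm_add_le _ _).trans (by linarith)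
  have hcontr : ContractingWith (1 / 2) (hmaps.restrict P S S) := by
    refine ⟨by norm_num, LipschitzWith.of_dist_le_mul fun h₁ h₂ => ?_⟩
    rw [Subtype.dist_eq, Subtype.dist_eq]
    refine (ContinuousMap.dist_le (by positivity)).2 fun t => ?_
    have h := hest (IccExtend hT h₁.1) (IccExtend hT h₂.1)
      (h₁.1.continuous.Icc_extend' (h := hT)) (h₂.1.continuous.Icc_extend' (h := hT))
      (fun s hs => (hSl _ h₁.2 hs).trans (hSl _ h₂.2 hs).symm) (hSr _ h₁.2) (hSr _ h₂.2)
      (dist h₁.1 h₂.1) dist_nonneg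
      (fun s hs => by
        rw [← dist_eq_norm]
        exact ContinuousMap.dist_apply_le_dist _) t t.2
    rw [dist_eq_norm]
    change ‖u₀ + volterra K (fun s => F s (IccExtend hT h₁.1 s)) t -
      (u₀ + volterra K (fun s => F s (IccExtend hT h₂.1 s)) t)‖ ≤ _
    rw [add_sub_add_left_eq_sub]
    refine h.trans (le_of_eq ?_)
    push_cast
    ring
  have hx : (⟨fun t => φ₀ t, by fun_prop⟩ : C(Icc 0 (τ + δ), X)) ∈ S := fun t =>
    ⟨fun ht => hφ₀l t ⟨t.2.1, ht⟩, fun ht => by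
      change ‖φ₀ t - φ τ‖ ≤ ρ
      simpa [hφ₀r t ht] using hρ0.le⟩
  obtain ⟨ψ, -, hfix, -⟩ := hcontr.exists_fixedPoint' hScl.isComplete hmaps hx (edist_ne_top _ _)
  refine ⟨IccExtend hT ψ, (ψ.continuous.Icc_extend' (h := hT)).continuousOn, fun t ht => ?_⟩
  have := congrArg (fun h : C(Icc 0 (τ + δ), X) => h ⟨t, ht⟩) hfix
  rw [IccExtend_of_mem hT ψ ht]
  exact this.symm

/-- Either the Volterra equation has a global solution, or it has one on some `[0, ω)` which is
not the restriction of one on `[0, ω]`. -/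
lemma exists_global_or_maximal_isVolterraSolution [CompleteSpace X]
    (hK : ∀ T, 0 ≤ T → IntervalIntegrable K volume 0 T)
    (hF : ContinuousOn (Function.uncurry F) (Ici 0 ×ˢ univ)) (hL : LocallyLipschitzSnd F) :
    (∃ φ, ∀ T, IsVolterraSolution K F u₀ T φ) ∨
      ∃ ω > 0, ∃ φ, (∀ τ ∈ Ioo 0 ω, IsVolterraSolution K F u₀ τ φ) ∧
        ¬ ∃ ψ, IsVolterraSolution K F u₀ ω ψ := by
  set S : Set ℝ := {T | 0 ≤ T ∧ ∃ φ, IsVolterraSolution K F u₀ T φ} with hS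
  have hdown : ∀ T ∈ S, ∀ T', 0 ≤ T' → T' ≤ T → T' ∈ S := fun T hT T' h0 hle =>
    ⟨h0, hT.2.imp fun φ hφ => hφ.mono hle⟩
  have h0S : (0 : ℝ) ∈ S := ⟨le_rfl, _, isVolterraSolution_zero⟩
  have hext : ∀ T ∈ S, ∃ δ > 0, T + δ ∈ S := fun T hT => by
    obtain ⟨φ, hφ⟩ := hT.2
    obtain ⟨δ, hδ, ψ, hψ⟩ := exists_isVolterraSolution_continuation hK hF hL hT.1 hφ
    exact ⟨δ, hδ, by linarith [hT.1], ψ, hψ⟩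
  have hch : ∀ T : ℝ, ∃ φ : ℝ → X, T ∈ S → IsVolterraSolution K F u₀ T φ := fun T => by
    by_cases hT : T ∈ S
    · exact hT.2.imp fun φ hφ _ => hφ
    · exact ⟨0, fun h => absurd h hT⟩
  choose Ψ hΨ using hch
  -- Uniqueness makes solutions on different intervals compatible, so the diagonal `Ψ t t` glues
  -- them into one function.
  have hsol : ∀ T ∈ S, IsVolterraSolution K F u₀ T fun t => Ψ t t := fun T hT => by
    refine (hΨ T hT).congr fun t ht => ?_
    exact (hΨ t (hdown T hT t ht.1 ht.2)).eqOn hK hF hL ((hΨ T hT).mono ht.2) ⟨ht.1, le_rfl⟩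
  by_cases hb : BddAbove S
  · right
    have hlt : ∀ t, 0 ≤ t → t < sSup S → t ∈ S := fun t h0 ht => by
      obtain ⟨T, hT, htT⟩ := exists_lt_of_lt_csSup ⟨0, h0S⟩ ht
      exact hdown T hT t h0 htT.le
    -- An attained supremum would be passed by continuation.
    have hnot : sSup S ∉ S := fun h => by
      obtain ⟨δ, hδ, h'⟩ := hext _ h
      linarith [le_csSup hb h']
    obtain ⟨δ, hδ, h'⟩ := hext 0 h0S
    have hpos : 0 < sSup S := by linarith [le_csSup hb h']
    exact ⟨sSup S, hpos, _, fun τ hτ => hsol τ (hlt τ hτ.1.le hτ.2), fun h => hnot ⟨hpos.le, h⟩⟩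
  · left
    refine ⟨fun t => Ψ t t, fun T => ?_⟩
    obtain ⟨T', hT', hlt⟩ := not_bddAbove_iff.1 hb T
    exact (hsol T' hT').mono hlt.le

end VolterraEquation

/-! ### Continuity of `1/Γ`, then measurable representatives of `L^p`-valued functions. -/

/-- The complex function `1/Γ` is entire. -/
lemma continuous_inv_Gamma : Continuous fun s : ℝ => (Real.Gamma s)⁻¹ := by
  have h : Continuous fun s : ℝ => ((Complex.Gamma s)⁻¹).re :=
    Complex.continuous_re.comp
      (Complex.differentiable_one_div_Gamma.continuous.comp Complex.continuous_ofReal)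
  refine h.congr fun s => ?_
  rw [Complex.Gamma_ofReal, ← Complex.ofReal_inv, Complex.ofReal_re]

section LpTools

variable {E : Type*} [MeasurableSpace E] {μ : Measure E} {p : ℝ≥0∞} [Fact (1 ≤ p)]

/-- The geometric rate gives almost everywhere convergence of the whole sequence; convergence in
measure identifies the limit along a subsequence. Avoiding subsequences matters because one
depending on `t` would spoil joint measurability. -/
lemma ae_tendsto_of_norm_sub_lt_pow {f : ℕ → Lp ℝ p μ} {g : Lp ℝ p μ}
    (h : ∀ k, ‖f k - g‖ < (1 / 2 : ℝ) ^ k) :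
    ∀ᵐ x ∂μ, Tendsto (fun k => f k x) atTop (𝓝 (g x)) := by
  have hp : 1 ≤ p := Fact.out
  have hlim : Tendsto f atTop (𝓝 g) := by
    rw [tendsto_iff_norm_sub_tendsto_zero]
    exact squeeze_zero (fun _ => norm_nonneg _) (fun k => (h k).le)
      (tendsto_pow_atTop_nhds_zero_of_lt_one (by norm_num) (by norm_num))
  obtain ⟨ns, hns, hsub⟩ := (tendstoInMeasure_of_tendsto_Lp hlim).exists_seq_tendsto_ae
  have hsum : Summable fun k : ℕ => 2 * (1 / 2 : ℝ) ^ k :=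
    (summable_geometric_of_lt_one (by norm_num) (by norm_num)).mul_left 2
  have hconv := Lp.ae_tendsto_of_cauchy_eLpNorm (μ := μ) (p := p) (f := fun k => f k)
    (fun k => Lp.aestronglyMeasurable _) hp
    (B := fun k => ENNReal.ofReal (2 * (1 / 2 : ℝ) ^ k)) hsum.tsum_ofReal_ne_top
    (fun N n m hn hm => by
      rw [eLpNorm_congr_ae (Lp.coeFn_sub (f n) (f m)).symm, ← Lp.enorm_def,
        ← ofReal_norm, ENNReal.ofReal_lt_ofReal_iff (by positivity)]
      have h1 : ∀ j, N ≤ j → ‖f j - g‖ < (1 / 2 : ℝ) ^ N := fun j hj =>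
        (h j).trans_le (pow_le_pow_of_le_one (by norm_num) (by norm_num) hj)
      calc ‖f n - f m‖ = ‖(f n - g) - (f m - g)‖ := by congr 1; abel
        _ ≤ ‖f n - g‖ + ‖f m - g‖ := norm_sub_le _ _
        _ < _ := by linarith [h1 n hn, h1 m hm])
  filter_upwards [hsub, hconv] with x hx ⟨l, hl⟩
  rwa [tendsto_nhds_unique hx (hl.comp hns.tendsto_atTop)]

/-- A continuous `L^p`-valued function of time has a jointly measurable representative. -/
lemma exists_measurable_representative {g : ℝ → Lp ℝ p μ} (hg : Continuous g) :
    ∃ G : ℝ → E → ℝ, Measurable (Function.uncurry G) ∧ ∀ t, G t =ᵐ[μ] g t := by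
  classical
  let q := TopologicalSpace.denseSeq ℝ
  have hex : ∀ (k : ℕ) (t : ℝ), ∃ j, ‖g (q j) - g t‖ < (1 / 2 : ℝ) ^ k := fun k t => by
    have ho : IsOpen {s | ‖g s - g t‖ < (1 / 2 : ℝ) ^ k} :=
      isOpen_lt (by fun_prop) continuous_const
    exact (TopologicalSpace.denseRange_denseSeq ℝ).exists_mem_open ho ⟨t, by simp⟩
  -- Taking the first index of a dense sequence of times within the tolerance makes the choice
  -- measurable in `t`, with countably many values.
  let N : ℕ → ℝ → ℕ := fun k t => Nat.find (hex k t)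
  have hN : ∀ k t, ‖g (q (N k t)) - g t‖ < (1 / 2 : ℝ) ^ k := fun k t => Nat.find_spec (hex k t)
  have hNm : ∀ k, Measurable (N k) := fun k => measurable_find _ fun j =>
    (isOpen_lt (by fun_prop) continuous_const).measurableSet
  let Gk : ℕ → ℝ × E → ℝ := fun k z => g (q (N k z.1)) z.2
  have hGk : ∀ k, Measurable (Gk k) := fun k => by
    have h1 : Measurable fun z : ℕ × E => g (q z.1) z.2 :=
      measurable_from_prod_countable_right fun j =>
        (Lp.stronglyMeasurable (g (q j))).measurable
    exact h1.comp (((hNm k).comp measurable_fst).prodMk measurable_snd)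
  refine ⟨fun t x => limsup (fun k => Gk k (t, x)) atTop, Measurable.limsup hGk, fun t => ?_⟩
  filter_upwards [ae_tendsto_of_norm_sub_lt_pow fun k => hN k t] with x hx
  exact hx.limsup_eq

/-- Hölder's inequality on a set of finite measure, for every `p ≥ 1` including `∞`. -/
lemma exists_setIntegral_norm_le {s : Set E} (hμs : μ s < ∞) :
    ∃ C : ℝ, ∀ v : Lp ℝ p μ, IntegrableOn v s μ ∧ ∫ x in s, ‖v x‖ ∂μ ≤ C * ‖v‖ := by
  have hp : 1 ≤ p := Fact.out
  have : IsFiniteMeasure (μ.restrict s) := ⟨by simpa using hμs⟩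
  set c : ℝ≥0∞ := (μ.restrict s) univ ^ (1 / (1 : ℝ≥0∞).toReal - 1 / p.toReal) with hc
  have hc_top : c ≠ ∞ := by
    refine ENNReal.rpow_ne_top_of_nonneg ?_ (measure_ne_top _ _)
    rcases eq_or_ne p ∞ with rfl | hp'
    · simp
    · have : 1 ≤ p.toReal := by
        simpa using ENNReal.toReal_mono hp' hp
      simp only [ENNReal.toReal_one, ne_eq, one_ne_zero, not_false_eq_true, div_self, one_div,
        sub_nonneg]
      exact inv_le_one_of_one_le₀ this
  refine ⟨c.toReal, fun v => ?_⟩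
  have hvm : AEStronglyMeasurable v (μ.restrict s) := (Lp.aestronglyMeasurable v).restrict
  have hv : MemLp v p (μ.restrict s) := (Lp.memLp v).restrict s
  have hint : IntegrableOn v s μ := hv.integrable hp
  refine ⟨hint, ?_⟩
  have h1 : eLpNorm v 1 (μ.restrict s) ≤ eLpNorm v p μ * c :=
    (eLpNorm_le_eLpNorm_mul_rpow_measure_univ hp hvm).trans
      (mul_le_mul_left (eLpNorm_mono_measure _ Measure.restrict_le_self) _)
  rw [integral_norm_eq_lintegral_enorm hvm, ← eLpNorm_one_eq_lintegral_enorm, Lp.norm_def,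
    mul_comm, ← ENNReal.toReal_mul]
  exact ENNReal.toReal_mono (ENNReal.mul_ne_top (Lp.eLpNorm_ne_top v) hc_top) h1

/-- The integral over a set of finite measure, as a continuous functional on `L^p`. -/
lemma exists_setIntegralCLM {s : Set E} (hμs : μ s < ∞) :
    ∃ ℓ : Lp ℝ p μ →L[ℝ] ℝ, ∀ v, ℓ v = ∫ x in s, v x ∂μ := by
  obtain ⟨C, hC⟩ := exists_setIntegral_norm_le (μ := μ) (p := p) hμs
  refine ⟨LinearMap.mkContinuous
    { toFun := fun v => ∫ x in s, v x ∂μ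
      map_add' := fun v w => ?_
      map_smul' := fun c v => ?_ } C fun v => ?_, fun v => rfl⟩
  · rw [← integral_add (hC v).1 (hC w).1]
    exact integral_congr_ae (ae_restrict_of_ae (Lp.coeFn_add v w))
  · rw [RingHom.id_apply, smul_eq_mul, ← integral_const_mul]
    exact integral_congr_ae (ae_restrict_of_ae (Lp.coeFn_smul c v))
  · exact (norm_integral_le_integral_norm _).trans (hC v).2

/-- The Bochner integral of an `L^p`-valued function can be computed pointwise from a jointly
measurable representative. -/
lemma ae_integrable_and_integral_eq {T : Type*} [MeasurableSpace T] {ν : Measure T} [SFinite ν]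
    [SigmaFinite μ] {h : T → Lp ℝ p μ} (hh : Integrable h ν) {H : T → E → ℝ}
    (hH : AEStronglyMeasurable (Function.uncurry H) (ν.prod μ))
    (hHh : ∀ᵐ t ∂ν, H t =ᵐ[μ] h t) :
    ∀ᵐ x ∂μ, Integrable (fun t => H t x) ν ∧ (∫ t, h t ∂ν) x = ∫ t, H t x ∂ν := by
  have hint : ∀ s, μ s < ∞ → Integrable (Function.uncurry H) (ν.prod (μ.restrict s)) := by
    intro s hs
    obtain ⟨C, hC⟩ := exists_setIntegral_norm_le (μ := μ) (p := p) hs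
    have hm : AEStronglyMeasurable (Function.uncurry H) (ν.prod (μ.restrict s)) :=
      hH.mono_measure (Measure.prod_mono le_rfl Measure.restrict_le_self)
    rw [integrable_prod_iff hm]
    refine ⟨hHh.mono fun t ht => (hC (h t)).1.congr (ae_restrict_of_ae ht.symm), ?_⟩
    refine (hh.norm.const_mul C).mono' hm.norm.integral_prod_right' (hHh.mono fun t ht => ?_)
    rw [Real.norm_of_nonneg (integral_nonneg fun _ => norm_nonneg _)]
    refine le_trans (le_of_eq (integral_congr_ae ?_)) (hC (h t)).2
    filter_upwards [ae_restrict_of_ae ht] with x hx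
    simp [hx]
  have h1 : ∀ᵐ x ∂μ, Integrable (fun t => H t x) ν :=
    ae_of_forall_measure_lt_top_ae_restrict _ fun s _ hs => (hint s hs).prod_left_ae
  -- Integration over a set of finite measure is a continuous functional, so it commutes with the
  -- Bochner integral; Fubini does the same for `H`. Such integrals determine a function almost
  -- everywhere.
  have h2 : (∫ t, h t ∂ν : Lp ℝ p μ) =ᵐ[μ] fun x => ∫ t, H t x ∂ν := by
    refine ae_eq_of_forall_setIntegral_eq_of_sigmaFinite (fun s _ hs => ?_) (fun s _ hs => ?_)
      fun s _ hs => ?_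
    · obtain ⟨C, hC⟩ := exists_setIntegral_norm_le (μ := μ) (p := p) hs
      exact (hC _).1
    · exact (hint s hs).integral_prod_right
    · obtain ⟨ℓ, hℓ⟩ := exists_setIntegralCLM (μ := μ) (p := p) hs
      rw [← hℓ, ← ℓ.integral_comp_comm hh, ← integral_integral_swap (hint s hs)]
      refine integral_congr_ae (hHh.mono fun t ht => ?_)
      simp only [hℓ]
      exact integral_congr_ae (ae_restrict_of_ae ht.symm)
  filter_upwards [h1, h2] with x hx1 hx2 using ⟨hx1, hx2⟩

end LpTools

/-! ### Multiplication operators on `L^p`. -/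

section MulOp

variable {E : Type*} [MeasurableSpace E] {μ : Measure E} {p : ℝ≥0∞}
  {Y : Type*} [TopologicalSpace Y] [CompactSpace Y] [MeasurableSpace Y] [OpensMeasurableSpace Y]

lemma memLp_comp_mul {a : E → Y} (ha : Measurable a) (h : C(Y, ℝ)) (v : Lp ℝ p μ) :
    MemLp (fun x => h (a x) * v x) p μ := by
  refine MemLp.of_le_mul (c := ‖h‖) (Lp.memLp v)
    ((h.continuous.measurable.comp ha).aestronglyMeasurable.mul (Lp.aestronglyMeasurable v))
    (ae_of_all _ fun x => ?_)
  rw [norm_mul]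
  exact mul_le_mul_of_nonneg_right (h.norm_coe_le_norm _) (norm_nonneg _)

/-- Multiplication by `h ∘ a` on `L^p`, for continuous functions `h` on a compact space. -/
def mulComp (μ : Measure E) (p : ℝ≥0∞) [Fact (1 ≤ p)] {a : E → Y} (ha : Measurable a) :
    C(Y, ℝ) →L[ℝ] Lp ℝ p μ →L[ℝ] Lp ℝ p μ :=
  LinearMap.mkContinuous₂
    (LinearMap.mk₂ ℝ (fun h v => (memLp_comp_mul ha h v).toLp _)
      (fun h₁ h₂ v => by
        rw [← MemLp.toLp_add]
        exact MemLp.toLp_congr _ _ (ae_of_all _ fun x => by simp [add_mul]))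
      (fun c h v => by
        rw [← MemLp.toLp_const_smul]
        exact MemLp.toLp_congr _ _ (ae_of_all _ fun x => by simp [mul_assoc]))
      (fun h v w => by
        rw [← MemLp.toLp_add]
        refine MemLp.toLp_congr _ _ ?_
        filter_upwards [Lp.coeFn_add v w] with x hx
        change h (a x) * (v + w : Lp ℝ p μ) x = h (a x) * v x + h (a x) * w x
        rw [hx, Pi.add_apply, mul_add])
      (fun c h v => by
        rw [← MemLp.toLp_const_smul]
        refine MemLp.toLp_congr _ _ ?_
        filter_upwards [Lp.coeFn_smul c v] with x hx
        simp [hx, mul_left_comm]))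
    1 fun h v => by
      rw [one_mul, LinearMap.mk₂_apply]
      refine Lp.norm_le_mul_norm_of_ae_le_mul ?_
      filter_upwards [(memLp_comp_mul ha h v).coeFn_toLp] with x hx
      rw [hx, norm_mul]
      exact mul_le_mul_of_nonneg_right (h.norm_coe_le_norm _) (norm_nonneg _)

lemma mulComp_apply_ae [Fact (1 ≤ p)] {a : E → Y} (ha : Measurable a) (h : C(Y, ℝ)) (v : Lp ℝ p μ) :
    mulComp μ p ha h v =ᵐ[μ] fun x => h (a x) * v x :=
  (memLp_comp_mul ha h v).coeFn_toLp

lemma norm_mulComp_apply_le [Fact (1 ≤ p)] {a : E → Y} (ha : Measurable a) (h : C(Y, ℝ)) :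
    ‖mulComp μ p ha h‖ ≤ ‖h‖ := by
  simpa using (mulComp μ p ha).le_of_opNorm_le (LinearMap.mkContinuous₂_norm_le _ zero_le_one _) h

end MulOp

/-! ### The kernel of the variable-order fractional integral. -/

section Kernel

/-- The function `a ↦ r ^ (a - 1) / Γ(a)`, as a function of the logarithm of `r`. -/
def logKernel (α₀ : ℝ) : C(ℝ, C(Icc α₀ 1, ℝ)) :=
  ContinuousMap.curry ⟨fun z => Real.exp ((z.2 - 1) * z.1) * (Real.Gamma z.2)⁻¹,
    Continuous.mul (by fun_prop)
      (continuous_inv_Gamma.comp (continuous_subtype_val.comp continuous_snd))⟩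

lemma logKernel_apply {α₀ : ℝ} (y : ℝ) (a : Icc α₀ 1) :
    logKernel α₀ y a = Real.exp ((a - 1) * y) * (Real.Gamma a)⁻¹ := rfl

lemma logKernel_log_apply {α₀ r : ℝ} (hr : 0 < r) (a : Icc α₀ 1) :
    logKernel α₀ (Real.log r) a = r ^ ((a : ℝ) - 1) * (Real.Gamma a)⁻¹ := by
  rw [logKernel_apply, Real.rpow_def_of_pos hr, mul_comm (Real.log r)]

/-- Write `r^(a-1) = r^(a-α₀) r^(α₀-1)`: the first factor is bounded uniformly in `a` on `(0, T]`,
and `1/Γ` is bounded on `[α₀, 1]`. The remaining singularity is integrable when `α₀ > 0`. -/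
lemma exists_norm_logKernel_log_le (α₀ T : ℝ) :
    ∃ C, ∀ r ∈ Ioc 0 T, ‖logKernel α₀ (Real.log r)‖ ≤ C * r ^ (α₀ - 1) := by
  obtain ⟨B, hB⟩ := isCompact_Icc.exists_bound_of_continuousOn (s := Icc α₀ 1)
    continuous_inv_Gamma.continuousOn
  set B' := max B 0
  refine ⟨max 1 T ^ (1 - α₀) * B', fun r hr => ?_⟩
  have hm : (1 : ℝ) ≤ max 1 T := le_max_left _ _
  have hrpos := Real.rpow_pos_of_pos hr.1 (α₀ - 1)
  refine (ContinuousMap.norm_le _ (by positivity)).2 fun a => ?_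
  have h1 : r ^ ((a : ℝ) - 1) ≤ max 1 T ^ (1 - α₀) * r ^ (α₀ - 1) := by
    rw [show (a : ℝ) - 1 = (a - α₀) + (α₀ - 1) by ring, Real.rpow_add hr.1]
    refine mul_le_mul_of_nonneg_right ?_ hrpos.le
    calc r ^ ((a : ℝ) - α₀) ≤ max 1 T ^ ((a : ℝ) - α₀) :=
          Real.rpow_le_rpow hr.1.le (hr.2.trans (le_max_right _ _)) (sub_nonneg.2 a.2.1)
      _ ≤ _ := Real.rpow_le_rpow_of_exponent_le hm (by linarith [a.2.2])
  rw [logKernel_log_apply hr.1, norm_mul,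
    Real.norm_of_nonneg (Real.rpow_nonneg hr.1.le _), mul_right_comm]
  exact mul_le_mul h1 ((hB a a.2).trans (le_max_left _ _)) (norm_nonneg _) (by positivity)

variable {E : Type*} [MeasurableSpace E] {μ : Measure E} {p : ℝ≥0∞} [Fact (1 ≤ p)] {α₀ : ℝ}

/-- The operator kernel `r ^ (a(x) - 1) / Γ(a(x))` of the fractional integral of order `a(x)`. -/
def fracKernel (μ : Measure E) (p : ℝ≥0∞) [Fact (1 ≤ p)] {a : E → Icc α₀ 1}
    (ha : Measurable a) (r : ℝ) : Lp ℝ p μ →L[ℝ] Lp ℝ p μ :=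
  mulComp μ p ha (logKernel α₀ (Real.log r))

lemma intervalIntegrable_fracKernel (hα₀ : 0 < α₀) {a : E → Icc α₀ 1} (ha : Measurable a)
    {T : ℝ} (hT : 0 ≤ T) : IntervalIntegrable (fracKernel μ p ha) volume 0 T := by
  obtain ⟨C, hC⟩ := exists_norm_logKernel_log_le α₀ T
  have hpow : IntervalIntegrable (fun r : ℝ => C * r ^ (α₀ - 1)) volume 0 T :=
    (intervalIntegral.intervalIntegrable_rpow' (by linarith)).const_mul C
  rw [intervalIntegrable_iff_integrableOn_Ioc_of_le hT] at hpow ⊢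
  -- In the variable `log r` the kernel is a continuous curve of operators on all of `ℝ`, which
  -- gives strong measurability although the operator space need not be separable.
  have hm : StronglyMeasurable (fracKernel μ p ha) :=
    ((mulComp μ p ha).continuous.comp (logKernel α₀).continuous).stronglyMeasurable.comp_measurable
      Real.measurable_log
  refine hpow.mono' hm.aestronglyMeasurable ?_
  filter_upwards [ae_restrict_mem measurableSet_Ioc] with r hr
  exact (norm_mulComp_apply_le ha _).trans (hC r hr)

/-- A measurable version of `α` is projected onto `[α₀, 1]`, so that the kernel is defined at every
point and not just almost everywhere. -/
lemma exists_measurable_order {α : E → ℝ} (hα : AEMeasurable α μ) (hα₀ : α₀ ≤ 1)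
    (hmem : ∀ᵐ x ∂μ, α x ∈ Icc α₀ 1) :
    ∃ a : E → Icc α₀ 1, Measurable a ∧ ∀ᵐ x ∂μ, (a x : ℝ) = α x := by
  refine ⟨fun x => projIcc α₀ 1 hα₀ (hα.mk α x),
    continuous_projIcc.measurable.comp hα.measurable_mk, ?_⟩
  filter_upwards [hmem, hα.ae_eq_mk] with x hx hx'
  rw [← hx', projIcc_of_mem hα₀ hx]

/-- The Volterra convolution with the fractional kernel is the fractional integral of variable
order of a jointly measurable representative. -/
lemma ae_volterra_fracKernel_eq [SigmaFinite μ] (hα₀ : 0 < α₀) {a : E → Icc α₀ 1}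
    (ha : Measurable a) {I : Set ℝ} {t : ℝ} (ht : 0 ≤ t) (hI : Icc 0 t ⊆ I)
    {g : ℝ → Lp ℝ p μ} (hg : ContinuousOn g (Icc 0 t)) {G : ℝ → E → ℝ}
    (hG : AEStronglyMeasurable (Function.uncurry G) ((volume.restrict I).prod μ))
    (hGg : ∀ s ∈ I, G s =ᵐ[μ] g s) :
    ∀ᵐ x ∂μ, IntervalIntegrable (fun s => (t - s) ^ ((a x : ℝ) - 1) * G s x) volume 0 t ∧
      volterra (fracKernel μ p ha) g t x = rlIntegral (a x) (fun s => G s x) t := by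
  have hint := intervalIntegrable_kernel_apply_of_continuousOn
    (fun T hT => intervalIntegrable_fracKernel (μ := μ) (p := p) hα₀ ha hT) ht hg
  rw [intervalIntegrable_iff_integrableOn_Ioc_of_le ht] at hint
  have hmeas : Measurable fun z : ℝ × E =>
      Real.exp (((a z.2 : ℝ) - 1) * Real.log (t - z.1)) * (Real.Gamma (a z.2))⁻¹ := by
    have h1 : Measurable fun z : ℝ × E => (a z.2 : ℝ) := by fun_prop
    exact Measurable.mul (by fun_prop) (continuous_inv_Gamma.measurable.comp h1)
  have hH : AEStronglyMeasurable (Function.uncurry fun s x =>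
      logKernel α₀ (Real.log (t - s)) (a x) * G s x)
      ((volume.restrict (Ioc 0 t)).prod μ) :=
    hmeas.aestronglyMeasurable.mul (hG.mono_measure (Measure.prod_mono
      (Measure.restrict_mono (Ioc_subset_Icc_self.trans hI) le_rfl) le_rfl))
  have key := ae_integrable_and_integral_eq hint hH (by
    filter_upwards [ae_restrict_mem measurableSet_Ioc] with s hs
    filter_upwards [mulComp_apply_ae (p := p) ha (logKernel α₀ (Real.log (t - s))) (g s),
      hGg s (hI (Ioc_subset_Icc_self hs))] with x hx hx'
    rw [hx']
    exact hx.symm)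
  filter_upwards [key] with x hx
  have hapos : 0 < (a x : ℝ) := hα₀.trans_le (a x).2.1
  have hΓ := (Real.Gamma_pos_of_pos hapos).ne'
  have hae : ∀ᵐ s ∂(volume.restrict (Ioc 0 t)), logKernel α₀ (Real.log (t - s)) (a x) * G s x =
      (Real.Gamma (a x))⁻¹ * ((t - s) ^ ((a x : ℝ) - 1) * G s x) := by
    -- The point `s = t` is dropped: there `log 0 = 0`, and the two forms of the kernel disagree
    -- when `a x < 1`.
    rw [← restrict_Ioo_eq_restrict_Ioc]
    filter_upwards [ae_restrict_mem measurableSet_Ioo] with s hs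
    rw [logKernel_log_apply (sub_pos.2 hs.2)]
    ring
  constructor
  · rw [intervalIntegrable_iff_integrableOn_Ioc_of_le ht]
    refine ((hx.1.congr hae).const_mul (Real.Gamma (a x))).congr (ae_of_all _ fun s => ?_)
    field_simp
  · rw [volterra, intervalIntegral.integral_of_le ht, hx.2, integral_congr_ae hae,
      integral_const_mul, rlIntegral, if_neg hapos.ne', intervalIntegral.integral_of_le ht]

/-- The Bochner integral in time is the integral in time of a jointly measurable representative. -/
lemma ae_intervalIntegral_eq [SigmaFinite μ] {I : Set ℝ} {t : ℝ} (ht : 0 ≤ t) (hI : Icc 0 t ⊆ I)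
    {g : ℝ → Lp ℝ p μ} (hg : ContinuousOn g (Icc 0 t)) {G : ℝ → E → ℝ}
    (hG : AEStronglyMeasurable (Function.uncurry G) ((volume.restrict I).prod μ))
    (hGg : ∀ s ∈ I, G s =ᵐ[μ] g s) :
    ∀ᵐ x ∂μ, IntervalIntegrable (fun s => G s x) volume 0 t ∧
      (∫ s in (0 : ℝ)..t, g s) x = rlIntegral 1 (fun s => G s x) t := by
  have hint := hg.intervalIntegrable_of_Icc (μ := volume) ht
  rw [intervalIntegrable_iff_integrableOn_Ioc_of_le ht] at hint
  have key := ae_integrable_and_integral_eq hint (hG.mono_measure (Measure.prod_mono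
      (Measure.restrict_mono (Ioc_subset_Icc_self.trans hI) le_rfl) le_rfl)) (by
    filter_upwards [ae_restrict_mem measurableSet_Ioc] with s hs
    exact hGg s (hI (Ioc_subset_Icc_self hs)))
  filter_upwards [key] with x hx
  rw [intervalIntegrable_iff_integrableOn_Ioc_of_le ht, rlIntegral_one,
    intervalIntegral.integral_of_le ht, intervalIntegral.integral_of_le ht]
  exact hx

/-- The variable upper limit is absorbed into an indicator, leaving a parametric integral of a
jointly measurable function over the whole line. -/
lemma measurable_rlIntegral_uncurry {β : E → ℝ} (hβ : Measurable β) {G : ℝ → E → ℝ}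
    (hG : Measurable (Function.uncurry G)) :
    ∃ R : ℝ × E → ℝ, Measurable R ∧
      ∀ t, 0 ≤ t → ∀ x, R (t, x) = rlIntegral (β x) (fun s => G s x) t := by
  classical
  have hk : Measurable fun w : (ℝ × E) × ℝ => {w : (ℝ × E) × ℝ | 0 < w.2 ∧ w.2 ≤ w.1.1}.indicator
      (fun w => (w.1.1 - w.2) ^ (β w.1.2 - 1) * G w.2 w.1.2) w := by
    refine Measurable.indicator (Measurable.mul (Measurable.pow (by fun_prop) (by fun_prop))
      (hG.comp (measurable_snd.prodMk (measurable_snd.comp measurable_fst)))) ?_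
    exact (measurableSet_lt measurable_const measurable_snd).inter
      (measurableSet_le measurable_snd (measurable_fst.comp measurable_fst))
  refine ⟨fun z => if β z.2 = 0 then G z.1 z.2 else (Real.Gamma (β z.2))⁻¹ *
    ∫ s, {w : (ℝ × E) × ℝ | 0 < w.2 ∧ w.2 ≤ w.1.1}.indicator
      (fun w => (w.1.1 - w.2) ^ (β w.1.2 - 1) * G w.2 w.1.2) (z, s), ?_, fun t ht x => ?_⟩
  · refine Measurable.ite (measurableSet_eq_fun (by fun_prop) measurable_const) hG
      (Measurable.mul (continuous_inv_Gamma.measurable.comp (hβ.comp measurable_snd)) ?_)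
    exact hk.stronglyMeasurable.integral_prod_right'.measurable
  · simp only [rlIntegral]
    congr 2
    rw [intervalIntegral.integral_of_le ht, ← integral_indicator measurableSet_Ioc]
    congr 1

/-- Joint measurability of fractional integrals of variable order. -/
lemma aestronglyMeasurable_rlIntegral [SFinite μ] {β : E → ℝ} (hβ : AEMeasurable β μ)
    {I : Set ℝ} (hI : MeasurableSet I) (hI0 : ∀ t ∈ I, 0 ≤ t ∧ Icc 0 t ⊆ I) {G : ℝ → E → ℝ}
    (hG : AEStronglyMeasurable (Function.uncurry G) ((volume.restrict I).prod μ)) :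
    AEStronglyMeasurable
      (Function.uncurry fun t x => rlIntegral (β x) (fun s => G s x) t)
      ((volume.restrict I).prod μ) := by
  set G' : ℝ × E → ℝ := hG.mk _ with hG'
  have hG'm : Measurable G' := hG.stronglyMeasurable_mk.measurable
  obtain ⟨R, hR, hRe⟩ := measurable_rlIntegral_uncurry hβ.measurable_mk
    (G := fun t x => G' (t, x)) hG'm
  refine ⟨R, hR.stronglyMeasurable, ?_⟩
  have h1 : ∀ᵐ z ∂((volume.restrict I).prod μ), z.1 ∈ I :=
    Measure.quasiMeasurePreserving_fst.ae (ae_restrict_mem hI)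
  have h2 : ∀ᵐ z ∂((volume.restrict I).prod μ), β z.2 = hβ.mk β z.2 :=
    Measure.quasiMeasurePreserving_snd.ae hβ.ae_eq_mk
  -- A fractional integral at one time involves the whole trajectory at `x`, so the exceptional null
  -- set is sliced at fixed `x`.
  have h3 : ∀ᵐ x ∂μ, ∀ᵐ t ∂(volume.restrict I), G t x = G' (t, x) := by
    have hsw := Measure.measurePreserving_swap (μ := μ) (ν := volume.restrict I)
    exact Measure.ae_ae_of_ae_prod (hsw.quasiMeasurePreserving.ae hG.ae_eq_mk)
  have h4 : ∀ᵐ z ∂((volume.restrict I).prod μ),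
      ∀ᵐ t ∂(volume.restrict I), G t z.2 = G' (t, z.2) :=
    Measure.quasiMeasurePreserving_snd.ae h3
  filter_upwards [h1, h2, h4, hG.ae_eq_mk] with ⟨t, x⟩ ht hβx hx hz
  simp only at ht hβx hx
  rw [hRe t (hI0 t ht).1 x, ← hβx]
  simp only [Function.uncurry_apply_pair, rlIntegral]
  congr 2
  rw [intervalIntegral.integral_of_le (hI0 t ht).1, intervalIntegral.integral_of_le (hI0 t ht).1]
  refine integral_congr_ae ?_
  filter_upwards [ae_restrict_of_ae_restrict_of_subset
    (Ioc_subset_Icc_self.trans (hI0 t ht).2) hx] with s hs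
  rw [hs]

end Kernel

/-! ### Equivalence of the fractional derivative and the integral equation. -/

lemma continuous_extend_of_continuousOn {X : Type*} [TopologicalSpace X] {τ : ℝ} (hτ : 0 ≤ τ)
    {g : ℝ → X} (hg : ContinuousOn g (Icc 0 τ)) :
    ∃ g' : ℝ → X, Continuous g' ∧ EqOn g' g (Icc 0 τ) :=
  ⟨IccExtend hτ ((Icc 0 τ).domRestrict g), hg.domRestrict.Icc_extend' (h := hτ),
    fun t ht => by rw [IccExtend_of_mem hτ _ ht]; rfl⟩

lemma intervalIntegral_congr_Icc {X : Type*} [NormedAddCommGroup X] [NormedSpace ℝ X]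
    {t : ℝ} (ht : 0 ≤ t) {u v : ℝ → X} (h : EqOn u v (Icc 0 t)) :
    ∫ s in (0 : ℝ)..t, u s = ∫ s in (0 : ℝ)..t, v s :=
  intervalIntegral.integral_congr (by rwa [uIcc_of_le ht])

/-- Continuous functions with the same primitive are equal. -/
lemma eqOn_of_forall_intervalIntegral_eq {X : Type*} [NormedAddCommGroup X] [NormedSpace ℝ X]
    [CompleteSpace X] {τ : ℝ} (hτ : 0 < τ) {u v : ℝ → X} (hu : ContinuousOn u (Icc 0 τ))
    (hv : ContinuousOn v (Icc 0 τ))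
    (h : ∀ t ∈ Icc 0 τ, ∫ s in (0 : ℝ)..t, u s = ∫ s in (0 : ℝ)..t, v s) :
    EqOn u v (Icc 0 τ) := by
  obtain ⟨u', hu', huu'⟩ := continuous_extend_of_continuousOn hτ.le hu
  obtain ⟨v', hv', hvv'⟩ := continuous_extend_of_continuousOn hτ.le hv
  intro t ht
  have hd : ∀ {w : ℝ → X}, Continuous w →
      HasDerivWithinAt (fun t => ∫ s in (0 : ℝ)..t, w s) (w t) (Icc 0 τ) t := fun hw =>
    (intervalIntegral.integral_hasDerivAt_right (hw.intervalIntegrable _ _)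
      hw.aestronglyMeasurable.stronglyMeasurableAtFilter hw.continuousAt).hasDerivWithinAt
  have hEq : EqOn (fun t => ∫ s in (0 : ℝ)..t, u' s) (fun t => ∫ s in (0 : ℝ)..t, v' s)
      (Icc 0 τ) := fun s hs => by
    simp only
    rw [intervalIntegral_congr_Icc hs.1 (huu'.mono (Icc_subset_Icc_right hs.2)),
      intervalIntegral_congr_Icc hs.1 (hvv'.mono (Icc_subset_Icc_right hs.2)), h s hs]
  rw [← huu' ht, ← hvv' ht]
  exact (uniqueDiffOn_Icc hτ t ht).eq_deriv _ (hd hu')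
    ((hd hv').congr hEq (hEq ht))

lemma rlIntegral_zero (h : ℝ → ℝ) : rlIntegral 0 h = h := by
  ext t
  simp [rlIntegral]

lemma rlIntegral_rlIntegral_one_sub {a t : ℝ} (ha : 0 < a) (ha1 : a ≤ 1) (ht : 0 ≤ t) {h : ℝ → ℝ}
    (hh : IntervalIntegrable h volume 0 t) :
    rlIntegral a (rlIntegral (1 - a) h) t = rlIntegral 1 h t := by
  -- For `a = 1` the inner integral has order `0` and is the identity by definition; the semigroup
  -- law needs both orders positive.
  rcases ha1.eq_or_lt with rfl | h1
  · rw [sub_self, rlIntegral_zero]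
  · rw [rlIntegral_rlIntegral ha (sub_pos.2 h1) (by linarith) ht hh, add_sub_cancel]

lemma rlIntegral_one_sub_rlIntegral {a t : ℝ} (ha : 0 < a) (ha1 : a ≤ 1) (ht : 0 ≤ t) {h : ℝ → ℝ}
    (hh : IntervalIntegrable h volume 0 t) :
    RLIntegrable (1 - a) (rlIntegral a h) t ∧
      rlIntegral (1 - a) (rlIntegral a h) t = rlIntegral 1 h t := by
  rcases ha1.eq_or_lt with rfl | h1
  · rw [sub_self, rlIntegral_zero]
    exact ⟨Or.inl rfl, rfl⟩
  · rw [rlIntegral_rlIntegral (sub_pos.2 h1) ha (by linarith) ht hh, sub_add_cancel]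
    exact ⟨Or.inr (intervalIntegrable_rlIntegral (sub_pos.2 h1) ha (by linarith) ht hh), rfl⟩

section Equivalence

variable {n : ℕ} {p : ℝ≥0∞} {Ω : Set (EuclideanSpace ℝ (Fin n))} [Fact (1 ≤ p)] {α : EuclideanSpace ℝ (Fin n) → ℝ} {α₀ : ℝ}
  {a : EuclideanSpace ℝ (Fin n) → Icc α₀ 1}

/-- A solution of the fractional integral equation has the expected Caputo derivative. -/
lemma hasRLDerivOn_of_eq_volterra (hα₀ : 0 < α₀) (ha : Measurable a)
    (haα : ∀ᵐ x ∂(volume.restrict Ω), (a x : ℝ) = α x)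
    {I : Set ℝ} (hI : MeasurableSet I) (hI0 : ∀ t ∈ I, 0 ≤ t ∧ Icc 0 t ⊆ I)
    {ψ g g' : ℝ → LpOn p Ω} (hg' : Continuous g') (hgg' : EqOn g' g I)
    (hψ : ∀ t ∈ I, ψ t = volterra (fracKernel (volume.restrict Ω) p ha) g' t) :
    HasRLDerivOn α I ψ g := by
  obtain ⟨G, hGm, hG⟩ := exists_measurable_representative hg'
  have hGm' : AEStronglyMeasurable (Function.uncurry G)
      ((volume.restrict I).prod (volume.restrict Ω)) := hGm.aestronglyMeasurable
  have hαm : AEMeasurable α (volume.restrict Ω) :=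
    ⟨fun x => a x, by fun_prop, haα.mono fun x hx => hx.symm⟩
  -- The witness for `J^(1-α) ψ` is the primitive of `g'`, and the representative of `ψ` is the
  -- pointwise integral `J^α G`.
  refine ⟨fun t => ∫ s in (0 : ℝ)..t, g' s,
    ⟨fun t x => rlIntegral (α x) (fun s => G s x) t,
      ⟨aestronglyMeasurable_rlIntegral hαm hI hI0 hGm', fun t ht => ?_⟩, fun t ht => ?_⟩,
      fun t ht => ?_⟩
  · rw [hψ t ht]
    filter_upwards [haα, ae_volterra_fracKernel_eq hα₀ ha (hI0 t ht).1 (hI0 t ht).2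
      hg'.continuousOn hGm' fun s _ => hG s] with x hx hx'
    rw [hx'.2, hx]
  · filter_upwards [haα, ae_intervalIntegral_eq (hI0 t ht).1 (hI0 t ht).2
      hg'.continuousOn hGm' fun s _ => hG s] with x hx hx'
    have hpos : 0 < α x := hx ▸ hα₀.trans_le (a x).2.1
    have h1 := rlIntegral_one_sub_rlIntegral hpos (hx ▸ (a x).2.2) (hI0 t ht).1 hx'.1
    exact ⟨h1.1, hx'.2.trans h1.2.symm⟩
  · rw [← hgg' ht]
    exact (intervalIntegral.integral_hasDerivAt_right (hg'.intervalIntegrable _ _)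
      hg'.aestronglyMeasurable.stronglyMeasurableAtFilter hg'.continuousAt).hasDerivWithinAt

/-- A function with a given Riemann-Liouville derivative is the fractional integral of it. -/
lemma HasRLDerivOn.eq_volterra (hα₀ : 0 < α₀) (ha : Measurable a)
    (haα : ∀ᵐ x ∂(volume.restrict Ω), (a x : ℝ) = α x) {τ : ℝ} (hτ : 0 < τ)
    {ψ g : ℝ → LpOn p Ω} (hψ : ContinuousOn ψ (Icc 0 τ)) (hψ0 : ψ 0 = 0)
    (hg : ContinuousOn g (Icc 0 τ)) (h : HasRLDerivOn α (Icc 0 τ) ψ g) :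
    EqOn ψ (volterra (fracKernel (volume.restrict Ω) p ha) g) (Icc 0 τ) := by
  obtain ⟨W, ⟨Φ, hΦ, hWΦ⟩, hW⟩ := h
  set K := fracKernel (volume.restrict Ω) p ha
  have hK : ∀ T, 0 ≤ T → IntervalIntegrable K volume 0 T := fun T hT =>
    intervalIntegrable_fracKernel hα₀ ha hT
  have hαm : AEMeasurable α (volume.restrict Ω) :=
    ⟨fun x => a x, by fun_prop, haα.mono fun x hx => hx.symm⟩
  have hI0 : ∀ t ∈ Icc 0 τ, 0 ≤ t ∧ Icc 0 t ⊆ Icc 0 τ := fun t ht =>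
    ⟨ht.1, Icc_subset_Icc_right ht.2⟩
  have h0 : (0 : ℝ) ∈ Icc 0 τ := ⟨le_rfl, hτ.le⟩
  have hWc : ContinuousOn W (Icc 0 τ) := fun t ht => (hW t ht).continuousWithinAt
  -- Where `α x = 1` the order is `0` and `ψ 0 = 0` is needed; elsewhere the integral over `[0, 0]`
  -- vanishes.
  have hW0 : W 0 = 0 := by
    rw [Lp.eq_zero_iff_ae_eq_zero]
    have hψ0' : Φ 0 =ᵐ[volume.restrict Ω] 0 := by
      refine (hΦ.ae_eq 0 h0).trans ?_
      rw [hψ0]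
      exact Lp.coeFn_zero _ _ _
    filter_upwards [hWΦ 0 h0, hψ0'] with x hx hx'
    rw [hx.2, rlIntegral]
    split_ifs
    · exact hx'
    · simp
  have hWint : ∀ t ∈ Icc 0 τ, W t = ∫ s in (0 : ℝ)..t, g s := fun t ht => by
    rw [intervalIntegral.integral_eq_sub_of_hasDeriv_right_of_le ht.1
      (hWc.mono (hI0 t ht).2) (fun s hs => ?_)
      ((hg.mono (hI0 t ht).2).intervalIntegrable_of_Icc ht.1), hW0, sub_zero]
    have hs' : s ∈ Ioo 0 τ := ⟨hs.1, hs.2.trans_le ht.2⟩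
    exact ((hW s (Ioo_subset_Icc_self hs')).hasDerivAt
      (Icc_mem_nhds hs'.1 hs'.2)).hasDerivWithinAt
  -- `J^α J^(1-α) ψ = J^1 ψ`, computed at almost every `x`.
  have hstep1 : ∀ t ∈ Icc 0 τ, volterra K W t = ∫ s in (0 : ℝ)..t, ψ s := fun t ht => by
    refine Lp.ext ?_
    have hV := aestronglyMeasurable_rlIntegral (hαm.const_sub 1) measurableSet_Icc hI0
      hΦ.aestronglyMeasurable
    filter_upwards [haα, ae_volterra_fracKernel_eq hα₀ ha ht.1 (hI0 t ht).2
      (hWc.mono (hI0 t ht).2) hV fun s hs => (hWΦ s hs).mono fun x hx => hx.2.symm,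
      ae_intervalIntegral_eq ht.1 (hI0 t ht).2 (hψ.mono (hI0 t ht).2)
        hΦ.aestronglyMeasurable hΦ.ae_eq] with x hx hx1 hx2
    rw [hx1.2, hx2.2, ← hx]
    exact rlIntegral_rlIntegral_one_sub (hα₀.trans_le (a x).2.1) (a x).2.2 ht.1 hx2.1
  obtain ⟨g', hg', hgg'⟩ := continuous_extend_of_continuousOn hτ.le hg
  obtain ⟨G, hGm, hG⟩ := exists_measurable_representative hg'
  have hGm' : AEStronglyMeasurable (Function.uncurry G)
      ((volume.restrict (Icc 0 τ)).prod (volume.restrict Ω)) := hGm.aestronglyMeasurable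
  have hJg : ∀ t ∈ Icc 0 τ, volterra K g' t = volterra K g t := fun t ht =>
    volterra_congr ht.1 fun s hs => hgg' ⟨hs.1, hs.2.le.trans ht.2⟩
  -- Since `W = J^1 g`, both sides are `J^(1+α) g`: the two orders of integration commute.
  have hstep2 : ∀ t ∈ Icc 0 τ, volterra K W t = ∫ s in (0 : ℝ)..t, volterra K g' s :=
      fun t ht => by
    refine Lp.ext ?_
    have hR1 := aestronglyMeasurable_rlIntegral (μ := volume.restrict Ω) (β := fun _ => 1)
      aemeasurable_const measurableSet_Icc hI0 hGm'
    have hR2 := aestronglyMeasurable_rlIntegral hαm measurableSet_Icc hI0 hGm'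
    have hW1 : ∀ s ∈ Icc 0 τ,
        (fun x => rlIntegral 1 (fun r => G r x) s) =ᵐ[volume.restrict Ω] W s := fun s hs => by
      rw [hWint s hs, ← intervalIntegral_congr_Icc hs.1 (hgg'.mono (hI0 s hs).2)]
      filter_upwards [ae_intervalIntegral_eq hs.1 (hI0 s hs).2 hg'.continuousOn hGm'
        fun r _ => hG r] with x hx using hx.2.symm
    have hJ1 : ∀ s ∈ Icc 0 τ, (fun x => rlIntegral (α x) (fun r => G r x) s)
        =ᵐ[volume.restrict Ω] (volterra K g' s : LpOn p Ω) := fun s hs => by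
      filter_upwards [haα, ae_volterra_fracKernel_eq hα₀ ha hs.1 (hI0 s hs).2 hg'.continuousOn hGm'
        fun r _ => hG r] with x hx hx1
      rw [hx1.2, hx]
    filter_upwards [haα, ae_volterra_fracKernel_eq hα₀ ha ht.1 (hI0 t ht).2
      (hWc.mono (hI0 t ht).2) hR1 hW1,
      ae_intervalIntegral_eq ht.1 (hI0 t ht).2
        (continuousOn_volterra_of_continuousOn hK ht.1 hg'.continuousOn) hR2 hJ1,
      ae_intervalIntegral_eq ht.1 (hI0 t ht).2 hg'.continuousOn hGm' fun r _ => hG r]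
      with x hx hx1 hx2 hx3
    have hpos : 0 < (a x : ℝ) := hα₀.trans_le (a x).2.1
    rw [hx1.2, hx2.2, ← hx]
    exact (rlIntegral_rlIntegral hpos one_pos (by linarith) ht.1 hx3.1).trans
      ((congrArg (fun b => rlIntegral b _ t) (add_comm _ _)).trans
        (rlIntegral_rlIntegral one_pos hpos (by linarith) ht.1 hx3.1).symm)
  intro t ht
  rw [← hJg t ht]
  exact eqOn_of_forall_intervalIntegral_eq hτ hψ
    (continuousOn_volterra_of_continuousOn hK hτ.le hg'.continuousOn)
    (fun s hs => (hstep1 s hs).symm.trans (hstep2 s hs)) ht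

end Equivalence

lemma LocallyLipschitzSnd.clm_add {X : Type*} [NormedAddCommGroup X] [NormedSpace ℝ X]
    {f : ℝ → X → X} (hf : LocallyLipschitzSnd f) (A : X →L[ℝ] X) :
    LocallyLipschitzSnd fun t v => A v + f t v := by
  intro t₀ ht₀ φ₀
  obtain ⟨r, hr, L, hL, h⟩ := hf t₀ ht₀ φ₀
  refine ⟨r, hr, ‖A‖ + L, by positivity, fun t ht ψ φ hψ hφ => ?_⟩
  calc ‖A ψ + f t ψ - (A φ + f t φ)‖ = ‖A (ψ - φ) + (f t ψ - f t φ)‖ := by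
        rw [map_sub]; congr 1; abel
    _ ≤ ‖A‖ * ‖ψ - φ‖ + L * ‖ψ - φ‖ :=
        (norm_add_le _ _).trans (add_le_add (A.le_opNorm _) (h t ht ψ φ hψ hφ))
    _ = _ := by ring

lemma MapsBoundedToBounded.clm_add {X : Type*} [NormedAddCommGroup X] [NormedSpace ℝ X]
    {f : ℝ → X → X} (hf : MapsBoundedToBounded f) (A : X →L[ℝ] X) :
    MapsBoundedToBounded fun t v => A v + f t v := by
  intro B hB hBb
  obtain ⟨M, hM⟩ := (hf B hB hBb).exists_norm_le
  obtain ⟨C, hC⟩ := hBb.exists_norm_le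
  refine isBounded_iff_forall_norm_le.2 ⟨‖A‖ * C + M, ?_⟩
  rintro _ ⟨z, hz, rfl⟩
  exact (norm_add_le _ _).trans (add_le_add (A.le_opNorm_of_le
    ((norm_snd_le z).trans (hC z hz))) (hM _ ⟨z, hz, rfl⟩))

lemma continuousOn_uncurry_clm_add {X : Type*} [NormedAddCommGroup X] [NormedSpace ℝ X]
    {f : ℝ → X → X} {s : Set (ℝ × X)} (hf : ContinuousOn (Function.uncurry f) s)
    (A : X →L[ℝ] X) : ContinuousOn (Function.uncurry fun t v => A v + f t v) s :=
  (A.continuous.comp continuous_snd).continuousOn.add hf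

/-! ### Transfer of existence, uniqueness and blow-up to (P). -/

section Solutions

variable {n : ℕ} {p : ℝ≥0∞} {Ω : Set (EuclideanSpace ℝ (Fin n))} [Fact (1 ≤ p)]
  {α : EuclideanSpace ℝ (Fin n) → ℝ} {A : LpOn p Ω →L[ℝ] LpOn p Ω}
  {f : ℝ → LpOn p Ω → LpOn p Ω} {u₀ : LpOn p Ω}

lemma IsSolutionOn.mono {I J : Set ℝ} {φ : ℝ → LpOn p Ω} (h : IsSolutionOn α A f u₀ J φ)
    (hIJ : I ⊆ J) : IsSolutionOn α A f u₀ I φ := by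
  obtain ⟨W, ⟨Φ, hΦ, hWΦ⟩, hW⟩ := h.caputo
  exact ⟨h.continuousOn.mono hIJ, ⟨W, ⟨Φ,
    ⟨hΦ.aestronglyMeasurable.mono_measure
      (Measure.prod_mono (Measure.restrict_mono hIJ le_rfl) le_rfl),
      fun t ht => hΦ.ae_eq t (hIJ ht)⟩, fun t ht => hWΦ t (hIJ ht)⟩,
    fun t ht => (hW t (hIJ ht)).mono hIJ⟩, h.initial⟩

variable {α₀ : ℝ} {a : EuclideanSpace ℝ (Fin n) → Icc α₀ 1}

lemma IsSolutionOn.isVolterraSolution (hα₀ : 0 < α₀) (ha : Measurable a)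
    (haα : ∀ᵐ x ∂(volume.restrict Ω), (a x : ℝ) = α x)
    (hf : ContinuousOn (Function.uncurry f) (Ici 0 ×ˢ univ)) {τ : ℝ} (hτ : 0 < τ)
    {φ : ℝ → LpOn p Ω} (h : IsSolutionOn α A f u₀ (Icc 0 τ) φ) :
    IsVolterraSolution (fracKernel (volume.restrict Ω) p ha) (fun t v => A v + f t v) u₀ τ φ := by
  refine ⟨h.continuousOn, fun t ht => ?_⟩
  have := HasRLDerivOn.eq_volterra hα₀ ha haα hτ (h.continuousOn.sub continuousOn_const)
    (sub_self (φ 0)) (continuousOn_comp_of_continuousOn_uncurry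
      (continuousOn_uncurry_clm_add hf A) Icc_subset_Ici_self h.continuousOn) h.caputo ht
  rw [← this, h.initial, Pi.sub_apply, add_sub_cancel]

lemma isSolutionOn_of_isVolterraSolution (hα₀ : 0 < α₀) (ha : Measurable a)
    (haα : ∀ᵐ x ∂(volume.restrict Ω), (a x : ℝ) = α x) {I : Set ℝ} (hI : MeasurableSet I)
    (hI0 : ∀ t ∈ I, 0 ≤ t ∧ Icc 0 t ⊆ I) (h0 : 0 ∈ I)
    {φ : ℝ → LpOn p Ω} (hφ : ContinuousOn φ I) {g : ℝ → LpOn p Ω} (hg : Continuous g)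
    (hgφ : EqOn g (fun t => A (φ t) + f t (φ t)) I)
    (h : ∀ t ∈ I, IsVolterraSolution (fracKernel (volume.restrict Ω) p ha)
      (fun t v => A v + f t v) u₀ t φ) :
    IsSolutionOn α A f u₀ I φ := by
  have hinit : φ 0 = u₀ := (h 0 h0).initial le_rfl
  refine ⟨hφ, hasRLDerivOn_of_eq_volterra hα₀ ha haα hI hI0 hg hgφ fun t ht => ?_, hinit⟩
  rw [hinit, (h t ht).eq t ⟨(hI0 t ht).1, le_rfl⟩, add_sub_cancel_left]
  exact volterra_congr (hI0 t ht).1 fun s hs =>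
    (hgφ ((hI0 t ht).2 (Ico_subset_Icc_self hs))).symm

lemma IsVolterraSolution.isSolutionOn_Icc (hα₀ : 0 < α₀) (ha : Measurable a)
    (haα : ∀ᵐ x ∂(volume.restrict Ω), (a x : ℝ) = α x)
    (hf : ContinuousOn (Function.uncurry f) (Ici 0 ×ˢ univ)) {τ : ℝ} (hτ : 0 < τ)
    {φ : ℝ → LpOn p Ω} (h : IsVolterraSolution (fracKernel (volume.restrict Ω) p ha)
      (fun t v => A v + f t v) u₀ τ φ) :
    IsSolutionOn α A f u₀ (Icc 0 τ) φ := by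
  obtain ⟨g, hg, hgφ⟩ := continuous_extend_of_continuousOn hτ.le
    (continuousOn_comp_of_continuousOn_uncurry
      (continuousOn_uncurry_clm_add hf A) Icc_subset_Ici_self h.continuousOn)
  exact isSolutionOn_of_isVolterraSolution hα₀ ha haα measurableSet_Icc
    (fun t ht => ⟨ht.1, Icc_subset_Icc_right ht.2⟩) ⟨le_rfl, hτ.le⟩ h.continuousOn hg hgφ
    fun t ht => h.mono ht.2

lemma isSolutionOn_Ici_of_isVolterraSolution (hα₀ : 0 < α₀) (ha : Measurable a)
    (haα : ∀ᵐ x ∂(volume.restrict Ω), (a x : ℝ) = α x)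
    (hf : ContinuousOn (Function.uncurry f) (Ici 0 ×ˢ univ))
    {φ : ℝ → LpOn p Ω} (h : ∀ T, IsVolterraSolution (fracKernel (volume.restrict Ω) p ha)
      (fun t v => A v + f t v) u₀ T φ) :
    IsSolutionOn α A f u₀ (Ici 0) φ := by
  have hφ : ContinuousOn φ (Ici 0) := fun t ht => by
    refine ((h (t + 1)).continuousOn t ⟨ht, by linarith⟩).mono_of_mem_nhdsWithin ?_
    filter_upwards [self_mem_nhdsWithin,
      nhdsWithin_le_nhds (Iio_mem_nhds (show t < t + 1 by linarith))] with s hs hs'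
    exact ⟨hs, le_of_lt hs'⟩
  have hg := continuousOn_comp_of_continuousOn_uncurry
    (continuousOn_uncurry_clm_add hf A) Subset.rfl hφ
  exact isSolutionOn_of_isVolterraSolution hα₀ ha haα measurableSet_Ici
    (fun t ht => ⟨ht, Icc_subset_Ici_self⟩) self_mem_Ici hφ
    (hg.comp_continuous (f := fun t : ℝ => max t 0) (by fun_prop) fun t => mem_Ici.2 (le_max_right t 0))
    (fun t ht => by simp [show max t 0 = t from max_eq_left ht]) fun t _ => h t

/-- Uniqueness on each `[0, τ]` turns any solution on `[0, ω]` into an extension of `φ`. This serves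
both the blow-up and the incompatibility of the two alternatives. -/
lemma IsMaximalSolution.not_isSolutionOn_Icc {ω : ℝ} {φ : ℝ → LpOn p Ω}
    (h : IsMaximalSolution α A f u₀ ω φ) (ψ : ℝ → LpOn p Ω) :
    ¬ IsSolutionOn α A f u₀ (Icc 0 ω) ψ := fun hψ => by
  refine h.not_extendable ⟨ψ, hψ, fun t ht => ?_⟩
  have hω := h.pos
  have hτ : (t + ω) / 2 ∈ Ioo 0 ω := ⟨by linarith [ht.1], by linarith [ht.2]⟩
  exact h.unique _ hτ ψ (hψ.mono (Icc_subset_Icc_right hτ.2.le)) ⟨ht.1, by linarith [ht.2]⟩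

/-- A maximal solution blows up. -/
lemma IsMaximalSolution.limsup_enorm_eq_top (hα₀ : 0 < α₀) (ha : Measurable a)
    (haα : ∀ᵐ x ∂(volume.restrict Ω), (a x : ℝ) = α x)
    (hf : ContinuousOn (Function.uncurry f) (Ici 0 ×ˢ univ)) (hfb : MapsBoundedToBounded f)
    {ω : ℝ} {φ : ℝ → LpOn p Ω} (h : IsMaximalSolution α A f u₀ ω φ) :
    limsup (fun t => ‖φ t‖ₑ) (𝓝[<] ω) = ⊤ := by
  by_contra hne
  have hω := h.pos
  obtain ⟨C, hC, hCtop⟩ := exists_between (lt_top_iff_ne_top.2 hne)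
  have hev := eventually_lt_of_limsup_lt hC
  obtain ⟨b, hb, hbs⟩ := mem_nhdsLT_iff_exists_Ioo_subset.1 hev
  -- `c` lies beyond `b`, so the limsup bound holds after it, and in `(0, ω)`, so compactness bounds
  -- `φ` before it.
  set c := max ((b + ω) / 2) (ω / 2)
  have hbω : b < ω := hb
  have hcω : c < ω := max_lt (by linarith) (by linarith)
  have hbc : b < c := lt_of_lt_of_le (by linarith) (le_max_left _ _)
  have hc0 : 0 < c := lt_of_lt_of_le (by linarith) (le_max_right _ _)
  obtain ⟨M, hM⟩ := exists_norm_le_of_continuousOn_Icc (h.solution c ⟨hc0, hcω⟩).continuousOn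
  have hbd : ∀ t ∈ Ico 0 ω, ‖φ t‖ ≤ max M C.toReal := fun t ht => by
    rcases le_or_gt t c with htc | htc
    · exact (hM t ⟨ht.1, htc⟩).trans (le_max_left _ _)
    · have h1 : ‖φ t‖ₑ < C := hbs ⟨hbc.trans htc, ht.2⟩
      have h2 := ENNReal.toReal_mono hCtop.ne h1.le
      rw [toReal_enorm] at h2
      exact h2.trans (le_max_right _ _)
  obtain ⟨ψ, hψ, -⟩ := exists_isVolterraSolution_of_bounded
    (fun T hT => intervalIntegrable_fracKernel hα₀ ha hT) (continuousOn_uncurry_clm_add hf A)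
    (hfb.clm_add A) hω (fun τ hτ => (h.solution τ hτ).isVolterraSolution hα₀ ha haα hf hτ.1) hbd
  exact h.not_isSolutionOn_Icc ψ (hψ.isSolutionOn_Icc hα₀ ha haα hf hω)

lemma exists_global_or_maximal_solution (hα₀ : 0 < α₀) (ha : Measurable a)
    (haα : ∀ᵐ x ∂(volume.restrict Ω), (a x : ℝ) = α x)
    (hf : ContinuousOn (Function.uncurry f) (Ici 0 ×ˢ univ)) (hfl : LocallyLipschitzSnd f) :
    (∃ φ, IsSolutionOn α A f u₀ (Ici 0) φ) ∨
      ∃ ω φ, ContinuousOn φ (Ico 0 ω) ∧ IsMaximalSolution α A f u₀ ω φ := by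
  have hK : ∀ T, 0 ≤ T → IntervalIntegrable (fracKernel (volume.restrict Ω) p ha) volume 0 T :=
    fun T hT => intervalIntegrable_fracKernel hα₀ ha hT
  have hF := continuousOn_uncurry_clm_add hf A
  rcases exists_global_or_maximal_isVolterraSolution (u₀ := u₀) hK hF (hfl.clm_add A) with
    ⟨φ, hφ⟩ | ⟨ω, hω, φ, hφ, hnot⟩
  · exact Or.inl ⟨φ, isSolutionOn_Ici_of_isVolterraSolution hα₀ ha haα hf hφ⟩
  · refine Or.inr ⟨ω, φ, fun t ht => ?_, hω,
      fun τ hτ => (hφ τ hτ).isSolutionOn_Icc hα₀ ha haα hf hτ.1, fun τ hτ ψ hψ => ?_, ?_⟩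
    · have hτ : (t + ω) / 2 ∈ Ioo 0 ω := ⟨by linarith [ht.1], by linarith [ht.2]⟩
      have htτ : t < (t + ω) / 2 := by linarith [ht.2]
      refine ((hφ _ hτ).continuousOn t ⟨ht.1, htτ.le⟩).mono_of_mem_nhdsWithin ?_
      filter_upwards [self_mem_nhdsWithin, nhdsWithin_le_nhds (Iio_mem_nhds htτ)] with s hs hs'
      exact ⟨hs.1, le_of_lt hs'⟩
    · exact (hψ.isVolterraSolution hα₀ ha haα hf hτ.1).eqOn hK hF (hfl.clm_add A) (hφ τ hτ)
    · rintro ⟨ψ, hψ, -⟩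
      exact hnot ⟨ψ, hψ.isVolterraSolution hα₀ ha haα hf hω⟩

end Solutions

end VarOrder

end

theorem theorem4p3 {n : ℕ} (Ω : Set (EuclideanSpace ℝ (Fin n))) (hΩ : IsOpen Ω)
    (p : ℝ≥0∞) [Fact (1 ≤ p)]
    (α : EuclideanSpace ℝ (Fin n) → ℝ) (hα : MemLp α ∞ (volume.restrict Ω))
    (α₀ : ℝ) (hα₀ : α₀ ∈ Ioo (0 : ℝ) 1)
    (hα_mem : ∀ᵐ x ∂(volume.restrict Ω), α x ∈ Icc α₀ 1)
    (A : VarOrder.LpOn p Ω →L[ℝ] VarOrder.LpOn p Ω) (u₀ : VarOrder.LpOn p Ω)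
    (f : ℝ → VarOrder.LpOn p Ω → VarOrder.LpOn p Ω)
    (hf_cont : ContinuousOn (Function.uncurry f) (Ici 0 ×ˢ univ))
    (hf_lip : VarOrder.LocallyLipschitzSnd f)
    (hf_bdd : VarOrder.MapsBoundedToBounded f) :
    Xor
      (∃ φ : ℝ → VarOrder.LpOn p Ω, VarOrder.IsSolutionOn α A f u₀ (Ici 0) φ)
      (∃ (ω : ℝ) (φ : ℝ → VarOrder.LpOn p Ω), ContinuousOn φ (Ico 0 ω) ∧
        VarOrder.IsMaximalSolution α A f u₀ ω φ) ∧
    ∀ (ω : ℝ) (φ : ℝ → VarOrder.LpOn p Ω), VarOrder.IsMaximalSolution α A f u₀ ω φ →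
      limsup (fun t => ‖φ t‖ₑ) (𝓝[<] ω) = ⊤ := by
  obtain ⟨a, ha, haα⟩ := VarOrder.exists_measurable_order hα.aestronglyMeasurable.aemeasurable
    hα₀.2.le hα_mem
  refine ⟨?_, fun ω φ h => h.limsup_enorm_eq_top hα₀.1 ha haα hf_cont hf_bdd⟩
  -- A global solution restricts to a solution on `[0, ω]`, which no maximal solution allows.
  have hexcl : ∀ φ, VarOrder.IsSolutionOn α A f u₀ (Ici 0) φ →
      ∀ ω ψ, ¬ VarOrder.IsMaximalSolution α A f u₀ ω ψ := fun φ hφ ω ψ hψ =>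
    hψ.not_isSolutionOn_Icc φ (hφ.mono Icc_subset_Ici_self)
  rcases VarOrder.exists_global_or_maximal_solution (A := A) (u₀ := u₀) hα₀.1 ha haα hf_cont
    hf_lip with ⟨φ, hφ⟩ | ⟨ω, φ, hc, hφ⟩
  · exact Or.inl ⟨⟨φ, hφ⟩, fun ⟨ω, ψ, _, hψ⟩ => hexcl φ hφ ω ψ hψ⟩
  · exact Or.inr ⟨⟨ω, φ, hc, hφ⟩, fun ⟨ψ, hψ⟩ => hexcl ψ hψ ω φ hφ⟩
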